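/- Variables are named by finite binary strings, and a literal is a variable or its negation. A CNF formula is a finite list of clauses, each clause being a finite list of literals; formulas are encoded as strings over a fixed finite alphabet in the standard way. Let $\mathrm{E3CNF}$ be the set of nonempty CNF formulas in which every clause consists of exactly three literals that are pairwise distinct (a clause may contain a variable and its negation), and let $\mathrm{E3SAT}\subseteq\mathrm{E3CNF}$ be the set of satisfiable formulas in $\mathrm{E3CNF}$. For a clause $C$ of a formula $\psi$, let $\psi-C$ be the (possibly empty) formula that results from deleting this one clause. Theorem. There are a function $f$ from CNF formulas to CNF formulas and a function $\mathrm{sat}$ from CNF formulas to truth assignments (output as the finite list of the variables that are set to true, all others being false), both computable in polynomial time by a Turing machine, such that 1. $f$ is a many-one reduction from $\mathrm{E3SAT}$ to $\mathrm{E3SAT}$: for every CNF formula $\varphi$, $\varphi\in\mathrm{E3SAT}$ if and only if $f(\varphi)\in\mathrm{E3SAT}$; 2. for every $\varphi\in\mathrm{E3CNF}$, $f(\varphi)\in\mathrm{E3CNF}$, and for every clause $C$ of $f(\varphi)$, $\mathrm{sat}(f(\varphi)-C)$ is a satisfying assignment of $f(\varphi)-C$. -/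

import Mathlib

namespace CNFSat

open Computability

/-! ### CNF formulas and satisfiability -/

/-- Propositional variables are named by finite binary strings. -/
abbrev Var : Type := List Bool

/-- A literal: `(x, true)` is the variable `x`, and `(x, false)` is its negation. -/
abbrev Literal : Type := Var × Bool

/-- A clause is a finite disjunction of literals. -/
abbrev Clause : Type := List Literal

/-- A CNF formula is a finite conjunction of clauses. -/
abbrev Formula : Type := List Clause

/-- A truth assignment satisfies a CNF formula if it makes at least one literal true in every
clause. -/
def Satisfies (τ : Var → Bool) (φ : Formula) : Prop :=
  ∀ C ∈ φ, ∃ l ∈ C, τ l.1 = l.2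

/-- The nonempty CNF formulas with exactly three literals per clause, which are pairwise distinct.
A clause may contain a variable together with its negation. -/
def E3CNF : Set Formula :=
  {φ | φ ≠ [] ∧ ∀ C ∈ φ, C.length = 3 ∧ C.Nodup}

/-- The satisfiable formulas in `E3CNF`. -/
def E3SAT : Set Formula :=
  {φ | φ ∈ E3CNF ∧ ∃ τ : Var → Bool, Satisfies τ φ}

/-- The formula `φ - C`, where `C` is the clause of `φ` at position `i`: this one clause is
deleted and all the others are kept. -/
def deleteClause (φ : Formula) (i : Fin φ.length) : Formula :=
  φ.eraseIdx i

/-- An assignment as an output of an algorithm: the finite list of the variables that are set to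
true. All other variables are set to false. -/
abbrev FinAssignment : Type := List Var

/-- The truth assignment given by a list of true variables. -/
def FinAssignment.eval (T : FinAssignment) : Var → Bool :=
  fun x => decide (x ∈ T)

/-! ### Encodings as strings -/

/-- A literal is written as its sign, followed by the name of its variable and by a comma. -/
def encodeLiteral (l : Literal) : List Γ' :=
  Γ'.bit l.2 :: l.1.map Γ'.bit ++ [Γ'.comma]

/-- A clause is written as the sequence of its literals, followed by a closing bracket. -/
def encodeClause (C : Clause) : List Γ' :=
  C.flatMap encodeLiteral ++ [Γ'.ket]

/-- A formula is written as the sequence of its clauses. -/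
def encodeFormula (φ : Formula) : List Γ' :=
  φ.flatMap encodeClause

/-- A finite assignment is written as the sequence of the names of its true variables, each of them
followed by a comma. -/
def encodeAssignment (T : FinAssignment) : List Γ' :=
  T.flatMap fun x => x.map Γ'.bit ++ [Γ'.comma]

/-- One step of the left-to-right decoder. The state consists of the completed clauses, the
completed literals of the current clause and the bits of the current literal. -/
def decodeStep : Formula × Clause × List Bool → Γ' → Formula × Clause × List Bool
  | (φ, C, w), Γ'.bit b => (φ, C, w ++ [b])
  | (φ, C, w), Γ'.comma => (φ, C ++ [(w.tail, w.headI)], [])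
  | (φ, C, _), Γ'.ket => (φ ++ [C], [], [])
  | s, _ => s

theorem foldl_decodeStep_bits (φ : Formula) (C : Clause) (w v : List Bool) :
    (v.map Γ'.bit).foldl decodeStep (φ, C, w) = (φ, C, w ++ v) := by
  induction v generalizing w with
  | nil => simp
  | cons b v ih => simp [decodeStep, ih]

theorem foldl_decodeStep_literals (φ : Formula) (C D : Clause) :
    (D.flatMap encodeLiteral).foldl decodeStep (φ, C, []) = (φ, C ++ D, []) := by
  induction D generalizing C with
  | nil => simp
  | cons l D ih =>
    simp [encodeLiteral, List.foldl_append, decodeStep, foldl_decodeStep_bits, ih]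

theorem foldl_decodeStep_clauses (φ ψ : Formula) :
    (encodeFormula ψ).foldl decodeStep (φ, [], []) = (φ ++ ψ, [], []) := by
  induction ψ generalizing φ with
  | nil => simp [encodeFormula]
  | cons C ψ ih =>
    simp only [encodeFormula] at ih
    simp [encodeFormula, encodeClause, List.foldl_append, decodeStep, foldl_decodeStep_literals,
      ih]

/-- The encoding of CNF formulas as strings over the alphabet `Γ'`. -/
def formulaEncoding : Encoding Formula Γ' where
  encode := encodeFormula
  decode s := some (s.foldl decodeStep ([], [], [])).1
  decode_encode φ := by simp [foldl_decodeStep_clauses]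

/-- One step of the left-to-right decoder for assignments. -/
def decodeAssignmentStep : FinAssignment × List Bool → Γ' → FinAssignment × List Bool
  | (T, w), Γ'.bit b => (T, w ++ [b])
  | (T, w), Γ'.comma => (T ++ [w], [])
  | s, _ => s

theorem foldl_decodeAssignmentStep_bits (T : FinAssignment) (w v : List Bool) :
    (v.map Γ'.bit).foldl decodeAssignmentStep (T, w) = (T, w ++ v) := by
  induction v generalizing w with
  | nil => simp
  | cons b v ih => simp [decodeAssignmentStep, ih]

theorem foldl_decodeAssignmentStep (T S : FinAssignment) :
    (encodeAssignment S).foldl decodeAssignmentStep (T, []) = (T ++ S, []) := by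
  induction S generalizing T with
  | nil => simp [encodeAssignment]
  | cons x S ih =>
    simp only [encodeAssignment] at ih
    simp [encodeAssignment, List.foldl_append, decodeAssignmentStep,
      foldl_decodeAssignmentStep_bits, ih]

/-- The encoding of finite assignments as strings over the alphabet `Γ'`. -/
def assignmentEncoding : Encoding FinAssignment Γ' where
  encode := encodeAssignment
  decode s := some (s.foldl decodeAssignmentStep ([], [])).1
  decode_encode T := by simp [foldl_decodeAssignmentStep]

/-! ### Polynomial time -/

/-- `f` is computed by a multi-stack Turing machine in a number of steps that is bounded by a
polynomial in the length of the encoded input. -/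
def PolyTimeComputable {α β Γ₀ Γ₁ : Type} (ea : Encoding α Γ₀) (eb : Encoding β Γ₁) (f : α → β) :
    Prop :=
  Nonempty (Turing.TM2ComputableInPolyTime ea.encode eb.encode f)

/-- `f` is a polynomial-time many-one reduction from `A` to `B`. -/
def IsPolyTimeManyOneReduction {α β Γ₀ Γ₁ : Type} (ea : Encoding α Γ₀) (eb : Encoding β Γ₁)
    (A : Set α) (B : Set β) (f : α → β) : Prop :=
  PolyTimeComputable ea eb f ∧ ∀ x, x ∈ A ↔ f x ∈ B

end CNFSat

/-!
The reduction maps a formula to a chain of blocks, one for each clause `C n` that is not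
tautological. Between the blocks run the chain variables `u n`, `v n`, `c n`, and each block has a
selector `s n` and an escape variable `e n`. The block says that

* `u (n + 1) → u n ∨ s n` and `v n → v (n + 1) ∨ s n`,
* `C n ∨ e n`, where `e n → u n ∨ v (n + 1)`,
* `s n` implies that `C n` is false, that `c n` is false and that `c (n + 1)` is true, and
  `c n → c (n + 1)`.

The two ends of the chain say that `u 0 → c 0 ∧ v 0` and `v m → ¬ c m ∧ u m`. By the variables `c`,
at most one selector is true. A selector of a false clause has to use the escape of its block, which
leads along `u` or `v` to a second selector, and any other escape leads to a selector, too. Hence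
there is no escape at all, and all clauses hold (`chain_forces`). Conversely, if the clauses hold,
then all chain variables, selectors and escape variables can be false (`satisfies_gadget`). So the
gadget formula is satisfiable if and only if the given formula is.

Now let an arbitrary clause of the gadget formula be missing. Then the rest is satisfiable whether
or not the given formula is, and an assignment can be written down: the chain variables have one
triple of values up to the block of the missing clause and another triple above it, and at this
block the clause of the given formula is treated as false, or one of its literals is made true.
Whether each clause contains a true literal only depends on the kind of the clause, on the kind of
the missing clause and on the relative position of the two blocks, so that it is a finite check
(`exists_cert`). Variables of the given formula are needed in a single block only, where they are
distinct because the clause is not tautological. Therefore the values never conflict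
(`svarValue_congr`).

The implications are disjunctions of at most four literals, each of which is split into a pair of
clauses by a variable that occurs first positively and then negatively. Thus the first signs of the
clauses alternate, and a finite automaton that reads the signs finds the missing clause
(`search_spec`).

Both functions are computed by register machines. The one for the reduction reads its input once,
and the one for the assignment first finds the missing clause and then collects the true variables.
Register machines are translated via structured programs into the multi-stack machines of Mathlib
(`polyTimeComputable_of_exec`, `polyTimeComputable_of_phases`).
-/

namespace CNFSat

open Turing Computability

/-! ### A structured language for stack machines -/

/-- Structured programs over stacks `K` with symbols `A` and a finite control memory `σ`. -/
inductive Prog (K A σ : Type) : Type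
  /-- Pop from a stack and update the control memory with the result. -/
  | pop (k : K) (f : σ → Option A → σ)
  /-- Push a symbol that depends on the control memory. -/
  | push (k : K) (f : σ → A)
  /-- Update the control memory. -/
  | load (f : σ → σ)
  /-- Run two programs in sequence. -/
  | seq (p q : Prog K A σ)
  /-- Run the program selected by the control memory. -/
  | switch (p : σ → Prog K A σ)
  /-- Repeat the program as long as the test of the control memory succeeds. -/
  | loop (b : σ → Bool) (p : Prog K A σ)

namespace Prog

variable {K A σ : Type}

/-- The labels of the machine code of a program. -/
def Lab : Prog K A σ → Type
  | pop _ _ => Unit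
  | push _ _ => Unit
  | load _ => Unit
  | seq p q => Lab p ⊕ Lab q
  | switch p => Option (Σ v, Lab (p v))
  | loop _ p => Option (Lab p)

theorem finite_lab [Finite σ] (p : Prog K A σ) : Finite (Lab p) := by
  induction p with
  | pop | push | load => exact inferInstanceAs (Finite Unit)
  | seq p q hp hq => exact inferInstanceAs (Finite (Lab p ⊕ Lab q))
  | switch p hp => exact inferInstanceAs (Finite (Option (Σ v, Lab (p v))))
  | loop b p hp => exact inferInstanceAs (Finite (Option (Lab p)))

/-- The label at which the machine code of a program is entered. -/
def entry : (p : Prog K A σ) → Lab p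
  | pop _ _ => ()
  | push _ _ => ()
  | load _ => ()
  | seq p _ => Sum.inl (entry p)
  | switch _ => none
  | loop _ _ => none

/-- The machine code of a program whose labels are embedded by `emb` into the labels of a larger
machine, and which continues at the label `ex`. -/
def code {L : Type} : (p : Prog K A σ) → (Lab p → L) → L → Lab p → TM2.Stmt (fun _ : K => A) L σ
  | pop k f, _, ex, _ => .pop k f (.goto fun _ => ex)
  | push k f, _, ex, _ => .push k f (.goto fun _ => ex)
  | load f, _, ex, _ => .load f (.goto fun _ => ex)
  | seq p q, emb, _, Sum.inl l => code p (fun l => emb (.inl l)) (emb (.inr (entry q))) l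
  | seq _ q, emb, ex, Sum.inr l => code q (fun l => emb (.inr l)) ex l
  | switch p, emb, _, none => .goto fun v => emb (some ⟨v, entry (p v)⟩)
  | switch p, emb, ex, some ⟨v, l⟩ => code (p v) (fun l => emb (some ⟨v, l⟩)) ex l
  | loop b p, emb, ex, none =>
      .branch b (.goto fun _ => emb (some (entry p))) (.goto fun _ => ex)
  | loop _ p, emb, _, some l => code p (fun l => emb (some l)) (emb none) l

variable [DecidableEq K]

/-- `Exec p v S t v' S'`: the program `p`, started with control memory `v` and stacks `S`, stops
with `v'` and `S'` after exactly `t` steps. -/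
inductive Exec : Prog K A σ → σ → (K → List A) → ℕ → σ → (K → List A) → Prop
  | pop (k f v S) : Exec (pop k f) v S 1 (f v (S k).head?) (Function.update S k (S k).tail)
  | push (k f v S) : Exec (push k f) v S 1 v (Function.update S k (f v :: S k))
  | load (f v S) : Exec (load f) v S 1 (f v) S
  | seq {p q v₁ S₁ t₁ v₂ S₂ t₂ v₃ S₃} : Exec p v₁ S₁ t₁ v₂ S₂ → Exec q v₂ S₂ t₂ v₃ S₃ →
      Exec (seq p q) v₁ S₁ (t₁ + t₂) v₃ S₃
  | switch {p v S t v' S'} : Exec (p v) v S t v' S' → Exec (switch p) v S (1 + t) v' S'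
  | done {b p v S} : b v = false → Exec (loop b p) v S 1 v S
  | again {b p v S t₁ v₁ S₁ t₂ v₂ S₂} : b v = true → Exec p v S t₁ v₁ S₁ →
      Exec (loop b p) v₁ S₁ t₂ v₂ S₂ → Exec (loop b p) v S (1 + t₁ + t₂) v₂ S₂

theorem Exec.cast {p : Prog K A σ} {v S t v' S' t' v'' S''} (h : Exec p v S t v' S')
    (ht : t = t') (hv : v' = v'') (hS : S' = S'') : Exec p v S t' v'' S'' := by
  subst ht hv hS; exact h

theorem Exec.start {p : Prog K A σ} {v S t v' S' v₀ S₀} (h : Exec p v S t v' S')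
    (hv : v₀ = v) (hS : S₀ = S) : Exec p v₀ S₀ t v' S' := by
  subst hv hS; exact h

/-- The machine code of a program performs the execution of the program. The code may be embedded
into any machine `M` that agrees with it on its labels. -/
theorem Exec.evals {L : Type} {M : L → TM2.Stmt (fun _ : K => A) L σ} {p : Prog K A σ}
    {v S t v' S'} (h : Exec p v S t v' S') :
    ∀ {emb : Lab p → L} {ex : L}, (∀ l, M (emb l) = code p emb ex l) →
      (flip bind (TM2.step M))^[t] (some ⟨some (emb (entry p)), v, S⟩) =
        some ⟨some ex, v', S'⟩ := by
  induction h with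
  | pop k f v S =>
    intro emb ex hM
    have h := hM (entry (.pop k f))
    simp [flip, h, code]
  | push k f v S =>
    intro emb ex hM
    have h := hM (entry (.push k f))
    simp [flip, h, code]
  | load f v S =>
    intro emb ex hM
    have h := hM (entry (.load f))
    simp [flip, h, code]
  | @seq p q v₁ S₁ t₁ v₂ S₂ t₂ v₃ S₃ h₁ h₂ ih₁ ih₂ =>
    intro emb ex hM
    have e₁ := ih₁ (emb := fun l => emb (Sum.inl l)) (ex := emb (Sum.inr (entry q)))
      (fun l => hM (Sum.inl l))
    have e₂ := ih₂ (emb := fun l => emb (Sum.inr l)) (ex := ex) (fun l => hM (Sum.inr l))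
    rw [add_comm, Function.iterate_add_apply]
    exact (congrArg _ e₁).trans e₂
  | @switch p v S t v' S' h ih =>
    intro emb ex hM
    have h₀ : M (emb none) = .goto fun v => emb (some ⟨v, entry (p v)⟩) := hM none
    have e := ih (emb := fun l => emb (some ⟨v, l⟩)) (ex := ex) (fun l => hM (some ⟨v, l⟩))
    rw [add_comm, Function.iterate_add_apply]
    refine Eq.trans (congrArg _ ?_) e
    change some (TM2.stepAux (M (emb none)) v S) = _
    rw [h₀, TM2.stepAux]
  | @done b p v S hb =>
    intro emb ex hM
    have h₀ : M (emb none) = .branch b (.goto fun _ => emb (some (entry p))) (.goto fun _ => ex) :=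
      hM none
    change some (TM2.stepAux (M (emb none)) v S) = _
    rw [h₀, TM2.stepAux, hb, cond_false, TM2.stepAux]
  | @again b p v S t₁ v₁ S₁ t₂ v₂ S₂ hb h₁ h₂ ih₁ ih₂ =>
    intro emb ex hM
    have h₀ : M (emb none) = .branch b (.goto fun _ => emb (some (entry p))) (.goto fun _ => ex) :=
      hM none
    have e₁ := ih₁ (emb := fun l => emb (some l)) (ex := emb none) (fun l => hM (some l))
    have e₂ := ih₂ hM
    rw [add_comm, Function.iterate_add_apply, add_comm, Function.iterate_add_apply]
    refine Eq.trans (congrArg _ (Eq.trans (congrArg _ ?_) e₁)) e₂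
    change some (TM2.stepAux (M (emb none)) v S) = _
    rw [h₀, TM2.stepAux, hb, cond_true, TM2.stepAux]

/-- The machine that runs a program and then halts. The label `none` stands for the halting
statement at which the code of the program exits. -/
noncomputable def machine [Fintype K] [Fintype A] [Fintype σ] (k₀ k₁ : K) (v₀ : σ)
    (p : Prog K A σ) : FinTM2 :=
  haveI := finite_lab p
  { K := K
    k₀ := k₀
    k₁ := k₁
    Γ := fun _ => A
    Λ := Option (Lab p)
    main := some (entry p)
    ΛFin := Fintype.ofFinite _
    σ := σ
    initialState := v₀
    m := fun l => l.elim .halt (code p some none) }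

end Prog

open Prog in
/-- A function is computable in polynomial time if some program computes it on the input stack
`k₀` and the output stack `k₁` within a polynomial number of steps. -/
theorem polyTimeComputable_of_exec {α β K A σ : Type} [DecidableEq K] [Fintype K] [Fintype A]
    [Fintype σ] {ea : Computability.Encoding α A} {eb : Computability.Encoding β A} {f : α → β}
    (k₀ k₁ : K) (v₀ : σ) (p : Prog K A σ) (P : Polynomial ℕ)
    (h : ∀ x, ∃ t ≤ P.eval (ea.encode x).length,
      Exec p v₀ (Function.update (fun _ => []) k₀ (ea.encode x)) t v₀
        (Function.update (fun _ => []) k₁ (eb.encode (f x)))) :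
    PolyTimeComputable ea eb f := by
  choose t ht hE using h
  refine ⟨{
    tm := machine k₀ k₁ v₀ p
    inputAlphabet := Equiv.refl _
    outputAlphabet := Equiv.refl _
    time := P + 1
    outputsFun := fun x => ⟨⟨t x + 1, ?_⟩, by simpa using ht x⟩ }⟩
  have e := (hE x).evals (M := (machine k₀ k₁ v₀ p).m) (emb := some) (ex := none)
    (fun l => rfl)
  have hi : initList (machine k₀ k₁ v₀ p) ((ea.encode x).map (Equiv.refl A).invFun) =
      ⟨some (some (entry p)), v₀, Function.update (fun _ => []) k₀ (ea.encode x)⟩ := by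
    simp only [initList]
    congr 1
    funext k
    change K at k
    by_cases hk : k = k₀
    · subst hk
      refine (dif_pos rfl).trans (Eq.trans ?_ (Function.update_self (f := fun _ => []) k _).symm)
      exact List.map_id _
    · exact (dif_neg hk).trans (Function.update_of_ne (f := fun _ => []) hk _).symm
  have hf : haltList (machine k₀ k₁ v₀ p) ((eb.encode (f x)).map (Equiv.refl A).invFun) =
      ⟨none, v₀, Function.update (fun _ => []) k₁ (eb.encode (f x))⟩ := by
    simp only [haltList]
    congr 1
    funext k
    change K at k
    by_cases hk : k = k₁
    · subst hk
      refine (dif_pos rfl).trans (Eq.trans ?_ (Function.update_self (f := fun _ => []) k _).symm)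
      exact List.map_id _
    · exact (dif_neg hk).trans (Function.update_of_ne (f := fun _ => []) hk _).symm
  refine Eq.trans ?_ (congrArg some hf.symm)
  rw [add_comm, Function.iterate_add_apply]
  refine Eq.trans (congrArg _ (Eq.trans (congrArg _ (congrArg some hi)) e)) ?_
  rfl

/-! ### Register machines with a finite control -/

/-- The stacks of a register machine: the input, the output, two auxiliary stacks that are empty
between operations, and one stack for each register. -/
inductive Stack (R : Type) : Type
  | inp
  | out
  | tmp
  | tmp'
  | reg (r : R)
  deriving DecidableEq, Fintype

/-- The control memory of a register machine: its state, a flag, and two symbol buffers. Between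
operations the flag is `false` and the buffers are empty. -/
abbrev Ctl (Q A : Type) : Type := Q × Bool × Option A × Option A

/-- The control memory between two operations. -/
abbrev ctl {Q : Type} (A : Type) (q : Q) : Ctl Q A := (q, false, none, none)

/-- The memory of a register machine without its input. -/
structure Mem (Q A R : Type) where
  /-- The state of the finite control. -/
  q : Q
  /-- The output that has been produced, with the last symbol in front. -/
  out : List A
  /-- The contents of the registers, with the last symbol in front. -/
  reg : R → List A

/-- The stacks that represent an input and a memory. -/
def Mem.stk {Q A R : Type} (m : Mem Q A R) (i : List A) : Stack R → List A
  | .inp => i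
  | .out => m.out
  | .tmp => []
  | .tmp' => []
  | .reg r => m.reg r

namespace Prog

section Drain

variable {K A Q : Type} [DecidableEq K]

/-- Push a symbol if there is one. -/
def pushOpt (k : K) (f : Ctl Q A → Option A) : Prog K A (Ctl Q A) :=
  switch fun v => match f v with
    | none => load id
    | some a => push k fun _ => a

theorem exec_pushOpt (k : K) (f : Ctl Q A → Option A) (v : Ctl Q A) (S : K → List A) :
    Exec (pushOpt k f) v S 2 v (Function.update S k ((f v).toList ++ S k)) := by
  refine Exec.switch (t := 1) ?_
  cases h : f v with
  | none => exact (Exec.load id v S).cast rfl rfl (by simp)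
  | some a => exact Exec.push k (fun _ => a) v S

/-- Push the first buffered symbol on each of the given stacks. -/
def pushAll : List K → Prog K A (Ctl Q A)
  | [] => load id
  | k :: ks => seq (pushOpt k fun v => v.2.2.1) (pushAll ks)

theorem exec_pushAll {ks : List K} (hks : ks.Nodup) (q : Q) (b : Bool) (a : A) (S : K → List A) :
    Exec (pushAll ks) (q, b, some a, none) S (2 * ks.length + 1) (q, b, some a, none)
      (fun j => if j ∈ ks then a :: S j else S j) := by
  induction ks generalizing S with
  | nil => exact (Exec.load id _ S).cast rfl rfl (by simp)
  | cons k ks ih =>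
    refine ((exec_pushOpt k _ _ S).seq (ih hks.of_cons _)).cast ?_ rfl ?_
    · simp; ring
    · have hk : k ∉ ks := (List.nodup_cons.1 hks).1
      funext j
      by_cases hj : j = k
      · subst hj
        simp [hk]
      · simp [hj]

/-- Move the contents of the stack `k` to each of the stacks `ks`. -/
def drain (k : K) (ks : List K) : Prog K A (Ctl Q A) :=
  seq (pop k fun v a => (v.1, v.2.1, a, none))
    (loop (fun v => v.2.2.1.isSome)
      (seq (pushAll ks) (pop k fun v a => (v.1, v.2.1, a, none))))

theorem exec_drain_loop {k : K} {ks : List K} (hk : k ∉ ks) (hks : ks.Nodup) (q : Q) (b : Bool)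
    (l : List A) (S : K → List A) :
    Exec (loop (fun v => v.2.2.1.isSome)
        (seq (pushAll ks) (pop k fun v a => (v.1, v.2.1, a, none))))
      (q, b, l.head?, none) (Function.update S k l.tail) (1 + l.length * (2 * ks.length + 3))
      (q, b, none, none)
      (fun j => if j = k then [] else if j ∈ ks then l.reverse ++ S j else S j) := by
  induction l generalizing S with
  | nil =>
    refine (Exec.done rfl).cast (by simp) rfl ?_
    funext j
    by_cases hj : j = k
    · subst hj; simp
    · simp [hj]
  | cons a l ih =>
    have e := ih (fun j => if j ∈ ks then a :: S j else S j)
    have body := (exec_pushAll hks q b a (Function.update S k l)).seq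
      (Exec.pop k (fun v a => (v.1, v.2.1, a, none)) _ _)
    refine (Exec.again (b := fun v : Ctl Q A => v.2.2.1.isSome) rfl body
      (e.start ?_ ?_)).cast ?_ rfl ?_
    · simp [hk]
    · funext j
      by_cases hj : j = k
      · subst hj; simp [hk]
      · simp [hj]
    · simp only [List.length_cons]; ring
    · funext j
      by_cases hj : j = k
      · simp [hj]
      · by_cases hj' : j ∈ ks <;> simp [hj, hj']

theorem exec_drain {k : K} {ks : List K} (hk : k ∉ ks) (hks : ks.Nodup) (q : Q) (b : Bool)
    (x y : Option A) (S : K → List A) :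
    Exec (drain k ks) (q, b, x, y) S (2 + (S k).length * (2 * ks.length + 3)) (q, b, none, none)
      (fun j => if j = k then [] else if j ∈ ks then (S k).reverse ++ S j else S j) :=
  ((Exec.pop k _ _ S).seq (exec_drain_loop hk hks q b (S k) S)).cast (by ring) rfl rfl

/-- The first part of the comparison of the stacks `k` and `k'`: their contents are moved to `t`
and `t'`, and the flag tells whether they have been equal. -/
def compareMove [DecidableEq A] (k k' t t' : K) : Prog K A (Ctl Q A) :=
  seq (load fun v => (v.1, true, none, none)) <|
  seq (pop k fun v a => (v.1, v.2.1, a, none)) <|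
  seq (pop k' fun v a => (v.1, v.2.1, v.2.2.1, a)) <|
  loop (fun v => v.2.2.1.isSome || v.2.2.2.isSome) <|
  seq (load fun v => (v.1, v.2.1 && decide (v.2.2.1 = v.2.2.2), v.2.2)) <|
  seq (pushOpt t fun v => v.2.2.1) <|
  seq (pushOpt t' fun v => v.2.2.2) <|
  seq (pop k fun v a => (v.1, v.2.1, a, v.2.2.2)) <|
  pop k' fun v a => (v.1, v.2.1, v.2.2.1, a)

/-- The number `n` only bounds the lengths of the stacks, whose first symbols are buffered already.
The flag `b` tells whether the parts that have been compared before are equal. -/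
theorem exec_compareMove_loop [DecidableEq A] {k k' t t' : K} (h : [k, k', t, t'].Nodup)
    (q : Q) (n : ℕ) (b : Bool) (x y : List A) (hx : x.length ≤ n) (hy : y.length ≤ n)
    (S : K → List A) (hSx : S k = x.tail) (hSy : S k' = y.tail) :
    ∃ s ≤ 1 + 8 * n, Exec (loop (fun v => v.2.2.1.isSome || v.2.2.2.isSome) <|
        seq (load fun v => (v.1, v.2.1 && decide (v.2.2.1 = v.2.2.2), v.2.2)) <|
        seq (pushOpt t fun v => v.2.2.1) <|
        seq (pushOpt t' fun v => v.2.2.2) <|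
        seq (pop k fun v a => (v.1, v.2.1, a, v.2.2.2)) <|
        pop k' fun v a => (v.1, v.2.1, v.2.2.1, a))
      (q, b, x.head?, y.head?) S s (q, b && decide (x = y), none, none)
      (fun j => if j = k then [] else if j = k' then [] else
        if j = t then x.reverse ++ S t else if j = t' then y.reverse ++ S t' else S j) := by
  induction n generalizing b x y S with
  | zero =>
    obtain rfl : x = [] := by simpa using hx
    obtain rfl : y = [] := by simpa using hy
    refine ⟨1, by simp, (Exec.done rfl).cast rfl (by simp) ?_⟩
    funext j
    split_ifs <;> simp_all
  | succ n ih =>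
    by_cases h₀ : x = [] ∧ y = []
    · obtain ⟨rfl, rfl⟩ := h₀
      refine ⟨1, by simp, (Exec.done rfl).cast rfl (by simp) ?_⟩
      funext j
      split_ifs <;> simp_all
    · simp only [List.nodup_cons, List.mem_cons, List.not_mem_nil, or_false, not_or] at h
      obtain ⟨⟨hkk', hkt, hkt'⟩, ⟨hk't, hk't'⟩, htt', -⟩ := h
      obtain ⟨s, hs, e⟩ := ih (b && decide (x.head? = y.head?)) x.tail y.tail
        (by simpa using hx) (by simpa using hy)
        (fun j => if j = k then x.tail.tail else if j = k' then y.tail.tail else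
          if j = t then x.head?.toList ++ S t else
          if j = t' then y.head?.toList ++ S t' else S j)
        (by simp) (by simp [Ne.symm hkk'])
      have body := (Exec.load (fun v : Ctl Q A => (v.1, v.2.1 && decide (v.2.2.1 = v.2.2.2), v.2.2))
        (q, b, x.head?, y.head?) S).seq
        ((exec_pushOpt t (fun v => v.2.2.1) _ _).seq
          ((exec_pushOpt t' (fun v => v.2.2.2) _ _).seq
            ((Exec.pop k (fun v a => (v.1, v.2.1, a, v.2.2.2)) _ _).seq
              (Exec.pop k' (fun v a => (v.1, v.2.1, v.2.2.1, a)) _ _))))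
      refine ⟨_, ?_, (Exec.again ?_ body (e.start ?_ ?_)).cast rfl ?_ ?_⟩
      · omega
      · cases x <;> cases y <;> simp_all
      · simp [Function.update_of_ne, hkt, hkt', hk't, hk't', hSx, hSy, Ne.symm hkk']
      · funext j
        by_cases h₁ : j = k
        · subst h₁
          simp [hkk', hkt, hkt', hSx]
        by_cases h₂ : j = k'
        · subst h₂
          simp [Ne.symm hkk', hk't, hk't', hSy]
        by_cases h₃ : j = t
        · subst h₃
          simp [Ne.symm hkt, Ne.symm hk't, htt']
        by_cases h₄ : j = t'
        · subst h₄
          simp [Ne.symm hkt', Ne.symm hk't', Ne.symm htt']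
        simp [h₁, h₂, h₃, h₄]
      · have hxy : x = y ↔ x.head? = y.head? ∧ x.tail = y.tail := by
          cases x <;> cases y <;> simp
        simp only [hxy, Bool.and_assoc, Bool.decide_and]
      · funext j
        by_cases h₁ : j = k
        · simp [h₁]
        by_cases h₂ : j = k'
        · simp [h₂]
        by_cases h₃ : j = t
        · subst h₃
          cases x <;> simp [h₁, h₂]
        by_cases h₄ : j = t'
        · subst h₄
          cases y <;> simp [h₁, h₂, h₃]
        simp [h₁, h₂, h₃, h₄]

/-- Compare the stacks `k` and `k'`, using the empty stacks `t` and `t'`, and update the state with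
the result. -/
def compare [DecidableEq A] (k k' t t' : K) (f : Bool → Q → Q) : Prog K A (Ctl Q A) :=
  seq (compareMove k k' t t') <| seq (drain t [k]) <| seq (drain t' [k']) <|
    load fun v => ctl A (f v.2.1 v.1)

theorem exec_compare [DecidableEq A] {k k' t t' : K} (h : [k, k', t, t'].Nodup)
    (f : Bool → Q → Q) (q : Q) (n : ℕ) (S : K → List A) (hx : (S k).length ≤ n)
    (hy : (S k').length ≤ n) (ht : S t = []) (ht' : S t' = []) :
    ∃ s ≤ 20 * (n + 1), Exec (compare k k' t t' f) (ctl A q) S s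
      (ctl A (f (decide (S k = S k')) q)) S := by
  obtain ⟨s, hs, e⟩ := exec_compareMove_loop h q n true (S k) (S k') hx hy
    (Function.update (Function.update S k (S k).tail) k' (S k').tail)
    (by simp_all) (by simp)
  simp only [List.nodup_cons, List.mem_cons, List.not_mem_nil, or_false, not_or] at h
  obtain ⟨⟨hkk', hkt, hkt'⟩, ⟨hk't, hk't'⟩, htt', -⟩ := h
  have m : Exec (compareMove (Q := Q) k k' t t') (ctl A q) S _ _ _ :=
    (Exec.load _ _ _).seq ((Exec.pop k _ _ _).seq ((Exec.pop k' _ _ _).seq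
      (e.start (by simp [Ne.symm hkk']) (by simp [Ne.symm hkk']))))
  have d := exec_drain (k := t) (ks := [k]) (by simp [Ne.symm hkt]) (by simp) q
    (true && decide (S k = S k')) none none
    (fun j => if j = k then [] else if j = k' then [] else
      if j = t then (S k).reverse else if j = t' then (S k').reverse else S j)
  have d' := exec_drain (k := t') (ks := [k']) (by simp [Ne.symm hk't']) (by simp) q
    (true && decide (S k = S k')) none none
    (fun j => if j = k then S k else if j = k' then [] else
      if j = t then [] else if j = t' then (S k').reverse else S j)
  simp only [Ne.symm hkt, Ne.symm hk't, Ne.symm hkt', Ne.symm hk't', Ne.symm htt', if_false,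
    if_true, List.length_reverse] at d d'
  refine ⟨_, ?_, (m.seq ((d.start rfl ?_).seq ((d'.start rfl ?_).seq
    (Exec.load (fun v : Ctl Q A => ctl A (f v.2.1 v.1)) _ _)))).cast rfl ?_ ?_⟩
  · simp only [List.length_cons, List.length_nil]
    omega
  · funext j
    simp [Function.update_of_ne, Ne.symm hkt, Ne.symm hk't, Ne.symm hkt', Ne.symm hk't', ht, ht']
    split_ifs <;> simp [Function.update_of_ne, *]
  · funext j
    by_cases h₁ : j = k
    · subst h₁
      simp [hkt]
    by_cases h₃ : j = t
    · subst h₃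
      simp [Ne.symm hkt, Ne.symm hk't]
    simp [h₁, h₃]
  · simp
  · funext j
    by_cases h₁ : j = k
    · subst h₁
      simp [hkk', hkt']
    by_cases h₂ : j = k'
    · subst h₂
      simp [hk't', h₁]
    by_cases h₃ : j = t
    · subst h₃
      simp [htt', ht, h₁, h₂]
    by_cases h₄ : j = t'
    · subst h₄
      simp [ht']
    simp [h₁, h₂, h₃, h₄]

end Drain

end Prog

/-! ### Operations and phases of a register machine -/

/-- The operations of a register machine. -/
inductive Op (Q A R : Type) : Type
  /-- Write a symbol in front of the output. -/
  | emit (a : A)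
  /-- Push a symbol on a register. -/
  | push (r : R) (a : A)
  /-- Write the reverse of a register, which keeps its contents, in front of the output. -/
  | copy (r : R)
  /-- Empty a register. -/
  | clear (r : R)
  /-- Update the state according to whether two registers have the same contents. -/
  | cmp (r r' : R) (f : Bool → Q → Q)
  /-- Update the state. -/
  | upd (f : Q → Q)

section Machine

set_option linter.unusedSectionVars false

variable {Q A R : Type} [DecidableEq A] [DecidableEq R]

/-- The effect of an operation. -/
def Op.run : Op Q A R → Mem Q A R → Mem Q A R
  | emit a, m => { m with out := a :: m.out }
  | push r a, m => { m with reg := Function.update m.reg r (a :: m.reg r) }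
  | copy r, m => { m with out := (m.reg r).reverse ++ m.out }
  | clear r, m => { m with reg := Function.update m.reg r [] }
  | cmp r r' f, m => { m with q := f (decide (m.reg r = m.reg r')) m.q }
  | upd f, m => { m with q := f m.q }

/-- The effect of a list of operations. -/
def runOps (l : List (Op Q A R)) (m : Mem Q A R) : Mem Q A R :=
  l.foldl (fun m o => o.run m) m

/-- The effect of a list of actions. Each action is a list of operations that depends on the state
at the beginning of the action. -/
def runActs (l : List (Q → List (Op Q A R))) (m : Mem Q A R) : Mem Q A R :=
  l.foldl (fun m g => runOps (g m.q) m) m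

/-- The phases of a computation. -/
inductive Phase (Q A R : Type) : Type
  /-- Read the input and perform for each of its symbols the given actions. -/
  | pass (g : A → List (Q → List (Op Q A R)))
  /-- Move a register to the input, which reverses the contents of the register. -/
  | pour (r : R)
  /-- Perform a single action. -/
  | act (g : Q → List (Op Q A R))

/-- The effect of a phase on the input and the memory. -/
def Phase.run : Phase Q A R → List A × Mem Q A R → List A × Mem Q A R
  | pass g, s => ([], s.1.foldl (fun m a => runActs (g a) m) s.2)
  | pour r, s => ((s.2.reg r).reverse ++ s.1, { s.2 with reg := Function.update s.2.reg r [] })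
  | act g, s => (s.1, runOps (g s.2.q) s.2)

/-- The program `p` performs the operation `F` on the memory within a time that is linear in the
lengths of the registers, and it lengthens the registers by at most a constant. -/
def Implements (p : Prog (Stack R) A (Ctl Q A)) (F : Mem Q A R → Mem Q A R) : Prop :=
  ∃ c, ∀ (B : ℕ) (m : Mem Q A R) (i : List A), (∀ r, (m.reg r).length ≤ B) →
    (∀ r, ((F m).reg r).length ≤ B + c) ∧
    ∃ t ≤ c * (B + 1), Prog.Exec p (ctl A m.q) (m.stk i) t (ctl A (F m).q) ((F m).stk i)

theorem Implements.seq {p p' : Prog (Stack R) A (Ctl Q A)} {F F' : Mem Q A R → Mem Q A R}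
    (h : Implements p F) (h' : Implements p' F') :
    Implements (p.seq p') (fun m => F' (F m)) := by
  obtain ⟨c, h⟩ := h
  obtain ⟨c', h'⟩ := h'
  refine ⟨c + c' * (c + 1), fun B m i hm => ?_⟩
  obtain ⟨h₁, t, ht, e⟩ := h B m i hm
  obtain ⟨h₂, t', ht', e'⟩ := h' (B + c) (F m) i h₁
  refine ⟨fun r => (h₂ r).trans (by nlinarith), t + t', ?_, e.seq e'⟩
  calc t + t' ≤ c * (B + 1) + c' * (B + c + 1) := add_le_add ht ht'
    _ ≤ (c + c' * (c + 1)) * (B + 1) := by nlinarith [Nat.zero_le (c' * c * B)]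

theorem implements_skip (f : Ctl Q A → Ctl Q A) (hf : ∀ q, f (ctl A q) = ctl A q) :
    Implements (R := R) (.load f) id :=
  ⟨1, fun B m i hm => ⟨fun r => (hm r).trans (by simp), 1, by omega,
    (Prog.Exec.load _ _ _).cast rfl (hf _) rfl⟩⟩

theorem Implements.switch [Finite Q] {p : Ctl Q A → Prog (Stack R) A (Ctl Q A)}
    {F : Q → Mem Q A R → Mem Q A R} (h : ∀ q, Implements (p (ctl A q)) (F q)) :
    Implements (.switch p) (fun m => F m.q m) := by
  choose c h using h
  obtain ⟨C, hC⟩ := (Set.finite_range c).bddAbove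
  have hC' : ∀ q, c q ≤ C := fun q => hC ⟨q, rfl⟩
  refine ⟨C + 1, fun B m i hm => ?_⟩
  obtain ⟨h₁, t, ht, e⟩ := h m.q B m i hm
  refine ⟨fun r => (h₁ r).trans (by have := hC' m.q; omega), 1 + t, ?_, .switch e⟩
  have := Nat.mul_le_mul_right (B + 1) (hC' m.q)
  nlinarith

/-- The program of an operation. -/
def Op.prog : Op Q A R → Prog (Stack R) A (Ctl Q A)
  | emit a => .push .out fun _ => a
  | push r a => .push (.reg r) fun _ => a
  | copy r => .seq (Prog.drain (.reg r) [.out, .tmp]) (Prog.drain .tmp [.reg r])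
  | clear r => Prog.drain (.reg r) []
  | cmp r r' f =>
      if r = r' then .load fun v => ctl A (f true v.1)
      else Prog.compare (.reg r) (.reg r') .tmp .tmp' f
  | upd f => .load fun v => ctl A (f v.1)

theorem Op.implements_prog (o : Op Q A R) : Implements o.prog o.run := by
  -- The comparison is the slowest operation, and its running time determines the constant.
  refine ⟨20, fun B m i hm => ?_⟩
  cases o with
  | emit a =>
    refine ⟨fun r => (hm r).trans (by simp), 1, by omega, (Prog.Exec.push _ _ _ _).cast rfl rfl ?_⟩
    funext j
    cases j <;> simp [Op.run, Mem.stk]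
  | push r a =>
    refine ⟨fun r' => ?_, 1, by omega, (Prog.Exec.push _ _ _ _).cast rfl rfl ?_⟩
    · have := hm r'
      by_cases hr : r' = r
      · subst hr
        simp [Op.run]; omega
      · simp [Op.run, hr]; omega
    · funext j
      cases j with
      | reg j =>
        by_cases hj : j = r
        · subst hj; simp [Op.run, Mem.stk]
        · simp [Op.run, Mem.stk, hj]
      | _ => simp [Op.run, Mem.stk]
  | copy r =>
    have d := Prog.exec_drain (k := Stack.reg r) (ks := [.out, .tmp]) (by simp) (by simp) m.q false
      none none (m.stk i)
    have d' := Prog.exec_drain (k := Stack.tmp) (ks := [.reg r]) (by simp) (by simp) m.q false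
      none none (fun j => if j = .reg r then [] else if j ∈ [Stack.out, .tmp] then
        (m.stk i (.reg r)).reverse ++ m.stk i j else m.stk i j)
    refine ⟨fun r => (hm r).trans (by simp), _, ?_, (d.seq d').cast rfl rfl ?_⟩
    · have := hm r
      simp [Mem.stk]
      omega
    · funext j
      cases j with
      | reg j =>
        by_cases hj : j = r
        · subst hj; simp [Op.run, Mem.stk]
        · simp [Op.run, Mem.stk, hj]
      | _ => simp [Op.run, Mem.stk]
  | clear r =>
    have d := Prog.exec_drain (k := Stack.reg r) (ks := []) (by simp) (by simp) m.q false
      none none (m.stk i)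
    refine ⟨fun r' => ?_, _, ?_, d.cast rfl rfl ?_⟩
    · have := hm r'
      by_cases hr : r' = r
      · subst hr
        simp [Op.run]
      · simp [Op.run, hr]; omega
    · have := hm r
      simp [Mem.stk]
      omega
    · funext j
      cases j with
      | reg j =>
        by_cases hj : j = r
        · subst hj; simp [Op.run, Mem.stk]
        · simp [Op.run, Mem.stk, hj]
      | _ => simp [Op.run, Mem.stk]
  | cmp r r' f =>
    refine ⟨fun r => (hm r).trans (by simp), ?_⟩
    by_cases hr : r = r'
    · subst hr
      refine ⟨1, by omega, ?_⟩
      simp only [Op.prog, if_true]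
      exact (Prog.Exec.load _ _ _).cast rfl (by simp [Op.run]) rfl
    · obtain ⟨s, hs, e⟩ := Prog.exec_compare (k := Stack.reg r) (k' := .reg r') (t := .tmp)
        (t' := .tmp') (by simp [hr]) f m.q B (m.stk i) (hm r) (hm r') rfl rfl
      refine ⟨s, hs, ?_⟩
      simp only [Op.prog, hr, if_false]
      exact e
  | upd f =>
    exact ⟨fun r => (hm r).trans (by simp), 1, by omega, Prog.Exec.load _ _ _⟩

/-- The program of a list of operations. -/
def opsProg (l : List (Op Q A R)) : Prog (Stack R) A (Ctl Q A) :=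
  l.foldr (fun o p => .seq o.prog p) (.load id)

theorem implements_opsProg (l : List (Op Q A R)) : Implements (opsProg l) (runOps l) := by
  induction l with
  | nil => exact implements_skip _ fun _ => rfl
  | cons o l ih => exact o.implements_prog.seq ih

/-- The program of a list of actions. -/
def actsProg (l : List (Q → List (Op Q A R))) : Prog (Stack R) A (Ctl Q A) :=
  l.foldr (fun g p => .seq (.switch fun v => opsProg (g v.1)) p) (.load id)

theorem implements_actsProg [Finite Q] (l : List (Q → List (Op Q A R))) :
    Implements (actsProg l) (runActs l) := by
  induction l with
  | nil => exact implements_skip _ fun _ => rfl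
  | cons g l ih =>
    exact (Implements.switch (p := fun v => opsProg (g v.1)) (F := fun q => runOps (g q))
      fun q => implements_opsProg (g q)).seq ih

/-- The program of a phase. -/
def Phase.prog : Phase Q A R → Prog (Stack R) A (Ctl Q A)
  | pass g =>
    .seq (.pop .inp fun v a => (v.1, false, a, none)) <|
    .loop (fun v => v.2.2.1.isSome) <|
    .seq (.switch fun v => match v.2.2.1 with
      | none => .load id
      | some a => .seq (.load fun v => ctl A v.1) (actsProg (g a))) <|
    .pop .inp fun v a => (v.1, false, a, none)
  | pour r => Prog.drain (.reg r) [.inp]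
  | act g => .switch fun v => opsProg (g v.1)

/-- The program `p` performs the operation `F` on the input and the memory in polynomial time. -/
def PolyImplements (p : Prog (Stack R) A (Ctl Q A))
    (F : List A × Mem Q A R → List A × Mem Q A R) : Prop :=
  ∃ P : Polynomial ℕ, ∀ (n : ℕ) (s : List A × Mem Q A R), s.1.length ≤ n →
    (∀ r, (s.2.reg r).length ≤ n) →
    (F s).1.length ≤ P.eval n ∧ (∀ r, ((F s).2.reg r).length ≤ P.eval n) ∧
    ∃ t ≤ P.eval n,
      Prog.Exec p (ctl A s.2.q) (s.2.stk s.1) t (ctl A (F s).2.q) ((F s).2.stk (F s).1)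

theorem PolyImplements.seq {p p' : Prog (Stack R) A (Ctl Q A)}
    {F F' : List A × Mem Q A R → List A × Mem Q A R}
    (h : PolyImplements p F) (h' : PolyImplements p' F') :
    PolyImplements (p.seq p') (fun s => F' (F s)) := by
  obtain ⟨P, h⟩ := h
  obtain ⟨P', h'⟩ := h'
  refine ⟨P + P'.comp P, fun n s hi hr => ?_⟩
  obtain ⟨h₁, h₂, t, ht, e⟩ := h n s hi hr
  obtain ⟨h₁', h₂', t', ht', e'⟩ := h' (P.eval n) (F s) h₁ h₂
  simp only [Polynomial.eval_add, Polynomial.eval_comp]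
  exact ⟨by omega, fun r => (h₂' r).trans (by omega), t + t', by omega, e.seq e'⟩

theorem Implements.polyImplements {p : Prog (Stack R) A (Ctl Q A)} {F : Mem Q A R → Mem Q A R}
    (h : Implements p F) : PolyImplements p (fun s => (s.1, F s.2)) := by
  obtain ⟨c, h⟩ := h
  refine ⟨(Polynomial.C c + 1) * (Polynomial.X + 1), fun n s hi hr => ?_⟩
  obtain ⟨h₁, t, ht, e⟩ := h n s.2 s.1 hr
  simp only [Polynomial.eval_mul, Polynomial.eval_add, Polynomial.eval_C, Polynomial.eval_X,
    Polynomial.eval_one]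
  exact ⟨by nlinarith, fun r => (h₁ r).trans (by nlinarith), t, by nlinarith, e⟩

/-- The loop of a pass. As every action lengthens the registers by at most a constant, they stay
within a linear bound, and the time is quadratic. The next symbol of the input is buffered already
whenever the loop tests whether there is one. -/
theorem exec_pass_loop [Finite Q] [Finite A] (g : A → List (Q → List (Op Q A R))) :
    ∃ c, ∀ (i : List A) (B : ℕ) (m : Mem Q A R), (∀ r, (m.reg r).length ≤ B) →
      (∀ r, ((i.foldl (fun m a => runActs (g a) m) m).reg r).length ≤ B + c * i.length) ∧
      ∃ t ≤ i.length * (c * (B + c * i.length + 1)) + 1,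
        Prog.Exec (.loop (fun v => v.2.2.1.isSome) <|
          .seq (.switch fun v => match v.2.2.1 with
            | none => .load id
            | some a => .seq (.load fun v => ctl A v.1) (actsProg (g a))) <|
          .pop .inp fun v a => (v.1, false, a, none))
          (m.q, false, i.head?, none) (m.stk i.tail) t
          (ctl A (i.foldl (fun m a => runActs (g a) m) m).q)
          ((i.foldl (fun m a => runActs (g a) m) m).stk []) := by
  choose c h using fun a => implements_actsProg (g a)
  obtain ⟨C, hC⟩ := (Set.finite_range c).bddAbove
  have hC' : ∀ a, c a ≤ C := fun a => hC ⟨a, rfl⟩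
  refine ⟨C + 4, fun i => ?_⟩
  induction i with
  | nil => exact fun B m hm => ⟨by simpa using hm, 1, by simp, .done rfl⟩
  | cons a i ih =>
    intro B m hm
    obtain ⟨h₁, t, ht, e⟩ := h a B m i hm
    obtain ⟨h₂, t', ht', e'⟩ := ih (B + (C + 4)) (runActs (g a) m)
      (fun r => (h₁ r).trans (by have := hC' a; omega))
    simp only [List.foldl_cons, List.length_cons]
    refine ⟨fun r => (h₂ r).trans (by ring_nf; omega), _, ?_,
      (Prog.Exec.again (b := fun v : Ctl Q A => v.2.2.1.isSome) rfl
        ((Prog.Exec.switch ((Prog.Exec.load (fun v => ctl A v.1) _ _).seq e)).seq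
          (Prog.Exec.pop Stack.inp (fun v a => (v.1, false, a, none)) _ _)) (e'.start ?_ ?_))⟩
    · have h₃ : t ≤ C * (B + 1) := ht.trans (Nat.mul_le_mul_right _ (hC' a))
      have h₄ : (C + 4) * (B + (C + 4) * (i.length + 1) + 1) ≥ C * (B + 1) + 4 := by
        nlinarith [Nat.zero_le (C * ((C + 4) * (i.length + 1))),
          Nat.zero_le ((C + 4) * (i.length + 1))]
      have h₅ : B + (C + 4) + (C + 4) * i.length + 1 = B + (C + 4) * (i.length + 1) + 1 := by ring
      rw [h₅] at ht'
      rw [Nat.add_mul, one_mul]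
      omega
    · rfl
    · funext j
      cases j <;> simp [Mem.stk]

theorem Phase.polyImplements_prog [Finite Q] [Finite A] (ph : Phase Q A R) :
    PolyImplements ph.prog ph.run := by
  cases ph with
  | pass g =>
    obtain ⟨c, h⟩ := exec_pass_loop g
    refine ⟨(Polynomial.X + 1) * ((Polynomial.C c + 2) * (Polynomial.X + Polynomial.C c *
      Polynomial.X + 1)), fun n s hi hr => ?_⟩
    obtain ⟨h₁, t, ht, e⟩ := h s.1 n s.2 hr
    simp only [Polynomial.eval_mul, Polynomial.eval_add, Polynomial.eval_C, Polynomial.eval_X,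
      Polynomial.eval_one, Polynomial.eval_ofNat]
    have h₂ : c * s.1.length ≤ c * n := Nat.mul_le_mul_left c hi
    have h₃ : s.1.length * (c * (n + c * s.1.length + 1)) ≤ n * (c * (n + c * n + 1)) := by
      gcongr
    have h₄ : (n + 1) * ((c + 2) * (n + c * n + 1)) = n * (c * (n + c * n + 1)) +
      (2 * n + c + 2) * (n + c * n + 1) := by ring
    have h₅ : n + c * n + 2 ≤ (2 * n + c + 2) * (n + c * n + 1) := by
      nlinarith [Nat.zero_le ((2 * n + c) * (n + c * n + 1))]
    refine ⟨Nat.zero_le _, fun r => (h₁ r).trans (by omega), 1 + t, by omega,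
      (Prog.Exec.pop Stack.inp (fun v a => (v.1, false, a, none)) _ _).seq (e.start rfl ?_)⟩
    funext j
    cases j <;> simp [Mem.stk]
  | pour r =>
    refine ⟨5 * Polynomial.X + 2, fun n s hi hr => ?_⟩
    have d := Prog.exec_drain (k := Stack.reg r) (ks := [.inp]) (by simp) (by simp) s.2.q false
      none none (s.2.stk s.1)
    have := hr r
    simp only [Polynomial.eval_mul, Polynomial.eval_add, Polynomial.eval_X, Polynomial.eval_ofNat]
    refine ⟨by simp [Phase.run]; omega, fun r' => ?_, _, ?_, d.cast rfl rfl ?_⟩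
    · have := hr r'
      by_cases hr : r' = r
      · subst hr
        simp [Phase.run]
      · simp [Phase.run, hr]; omega
    · simp [Mem.stk]; omega
    · funext j
      cases j with
      | reg j =>
        by_cases hj : j = r
        · subst hj; simp [Phase.run, Mem.stk]
        · simp [Phase.run, Mem.stk, hj]
      | _ => simp [Phase.run, Mem.stk]
  | act g =>
    exact (Implements.switch (p := fun v => opsProg (g v.1)) (F := fun q => runOps (g q))
      fun q => implements_opsProg (g q)).polyImplements

/-- The effect of a list of phases. -/
def runPhases (l : List (Phase Q A R)) (s : List A × Mem Q A R) : List A × Mem Q A R :=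
  l.foldl (fun s ph => ph.run s) s

theorem exists_polyImplements_runPhases [Finite Q] [Finite A] (l : List (Phase Q A R)) :
    ∃ p, PolyImplements p (runPhases l) := by
  induction l with
  | nil => exact ⟨_, (implements_skip id fun _ => rfl).polyImplements⟩
  | cons ph l ih =>
    obtain ⟨p, hp⟩ := ih
    exact ⟨_, ph.polyImplements_prog.seq hp⟩

theorem reg_runOps_clear (l : List R) (m : Mem Q A R) :
    runOps (l.map Op.clear) m =
      { m with reg := fun r => if r ∈ l then [] else m.reg r } := by
  induction l generalizing m with
  | nil => simp [runOps]
  | cons r l ih =>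
    change runOps (l.map Op.clear) (Op.run (.clear r) m) = _
    rw [ih]
    simp only [Op.run, Mem.mk.injEq, true_and]
    funext r'
    by_cases h : r' = r
    · simp [h]
    · simp [h]

end Machine

/-- A function is computable in polynomial time if a register machine computes it. -/
theorem polyTimeComputable_of_phases {α β Q A R : Type} [Fintype Q] [Fintype A] [Fintype R]
    [DecidableEq A] [DecidableEq R] {ea : Computability.Encoding α A}
    {eb : Computability.Encoding β A} {f : α → β} (q₀ : Q) (l : List (Phase Q A R))
    (h : ∀ x, (runPhases l (ea.encode x, ⟨q₀, [], fun _ => []⟩)).2.out = eb.encode (f x)) :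
    PolyTimeComputable ea eb f := by
  -- After the given phases, the input and the registers are cleared and the state is reset.
  let l' : List (Phase Q A R) := l ++ [.pass fun _ => [],
    .act fun _ => (Finset.univ.toList : List R).map Op.clear ++ [.upd fun _ => q₀]]
  obtain ⟨p, P, hp⟩ := exists_polyImplements_runPhases l'
  refine polyTimeComputable_of_exec (K := Stack R) .inp .out (ctl A q₀) p P fun x => ?_
  obtain ⟨-, -, t, ht, e⟩ := hp (ea.encode x).length (ea.encode x, ⟨q₀, [], fun _ => []⟩) le_rfl
    (by simp)
  refine ⟨t, ht, (e.start rfl ?_).cast rfl ?_ ?_⟩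
  · funext j
    cases j <;> simp [Mem.stk]
  · simp only [l', runPhases, List.foldl_append, List.foldl_cons, List.foldl_nil]
    simp [Phase.run, runOps, Op.run]
  · have hl : runPhases l' (ea.encode x, ⟨q₀, [], fun _ => []⟩) =
        ([], ⟨q₀, eb.encode (f x), fun _ => []⟩) := by
      rw [← h]
      simp only [l', runPhases, List.foldl_append, List.foldl_cons, List.foldl_nil]
      set s := List.foldl _ _ _
      simp only [Phase.run, runOps, List.foldl_append]
      change (([] : List A), Op.run (Op.upd fun _ => q₀) (runOps _ _)) = _
      rw [reg_runOps_clear]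
      have : ∀ i : List A, i.foldl (fun m a => runActs (Q := Q) (A := A) (R := R) [] m) s.2 =
          s.2 := by
        intro i
        induction i with
        | nil => rfl
        | cons a i ih => exact ih
      simp [Op.run, this]
    rw [hl]
    funext j
    cases j <;> simp [Mem.stk]

/-! ### Reading a formula clause by clause -/

/-- The state of the clause parser. -/
structure Parse : Type where
  /-- The number of literals of the current clause that have been completed, capped at 4. -/
  width : Fin 5
  /-- Whether the sign of the current literal has been read. -/
  inLit : Bool
  /-- The signs of the first three literals. -/
  sign : Fin 3 → Bool
  deriving DecidableEq, Fintype

/-- The parser at the beginning of a clause. -/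
def Parse.init : Parse := ⟨0, false, fun _ => false⟩

/-- The sign of the `k`-th literal of a clause, or `false` if there is no such literal. -/
def sgn (C : Clause) (k : Fin 3) : Bool := (C[(k : ℕ)]?.map Prod.snd).getD false

/-- The variable of the `k`-th literal of a clause, or `[]` if there is no such literal. -/
def name (C : Clause) (k : Fin 3) : Var := (C[(k : ℕ)]?.map Prod.fst).getD []

/-- The parser at the end of a clause. -/
def Parse.ofClause (C : Clause) : Parse := ⟨⟨min C.length 4, by omega⟩, false, sgn C⟩

section Reader

variable {E X : Type} [DecidableEq X]

/-- The parser begins a literal with the given sign. -/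
def Parse.beginLit (p : Parse) (b : Bool) : Parse :=
  ⟨p.width, true, fun k => if (k : ℕ) = p.width then b else p.sign k⟩

/-- The parser completes a literal. -/
def Parse.endLit (p : Parse) : Parse :=
  ⟨⟨min (p.width + 1) 4, by omega⟩, false, p.sign⟩

/-- The actions of a clause reader on a symbol. The registers `Sum.inl k` receive the variables of
the first three literals of each clause, after which the actions `acts` are performed. All symbols
are pushed on the registers in `sv`. -/
def readActs (acts : List (Parse × E → List (Op (Parse × E) Γ' (Fin 3 ⊕ X)))) (sv : List X)
    (a : Γ') : List (Parse × E → List (Op (Parse × E) Γ' (Fin 3 ⊕ X))) :=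
  let save : Parse × E → List (Op (Parse × E) Γ' (Fin 3 ⊕ X)) :=
    fun _ => sv.map fun x => .push (.inr x) a
  let reset : Parse × E → List (Op (Parse × E) Γ' (Fin 3 ⊕ X)) :=
    fun _ => [.clear (.inl 0), .clear (.inl 1), .clear (.inl 2), .upd fun q => (Parse.init, q.2)]
  match a with
  | .bit b => [save, fun q =>
      if q.1.inLit then
        if h : (q.1.width : ℕ) < 3 then [.push (.inl ⟨q.1.width, h⟩) (.bit b)] else []
      else [.upd fun q => (q.1.beginLit b, q.2)]]
  | .comma => [save, fun _ => [.upd fun q => (q.1.endLit, q.2)]]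
  | .ket => save :: (acts ++ [reset])
  | _ => [save]

/-- The memory of a clause reader with given contents. -/
def readMem (p : Parse) (e : E) (o : List Γ') (v : Fin 3 → Var) (r : X → List Γ') :
    Mem (Parse × E) Γ' (Fin 3 ⊕ X) :=
  ⟨(p, e), o, Sum.elim (fun k => ((v k).map Γ'.bit).reverse) r⟩

/-- The memory of a clause reader between two clauses. -/
def idle (e : E) (o : List Γ') (r : X → List Γ') : Mem (Parse × E) Γ' (Fin 3 ⊕ X) :=
  readMem Parse.init e o (fun _ => []) r

/-- Push a list of symbols on the registers in `sv`. -/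
def saved (sv : List X) (l : List Γ') (r : X → List Γ') : X → List Γ' :=
  fun x => if x ∈ sv then l.reverse ++ r x else r x

@[simp]
theorem saved_nil_left (l : List Γ') (r : X → List Γ') : saved [] l r = r := by
  funext x; simp [saved]

@[simp]
theorem saved_nil_right (sv : List X) (r : X → List Γ') : saved sv [] r = r := by
  funext x; simp [saved]

theorem saved_append (sv : List X) (l l' : List Γ') (r : X → List Γ') :
    saved sv (l ++ l') r = saved sv l' (saved sv l r) := by
  funext x
  by_cases h : x ∈ sv <;> simp [saved, h]

/-- The registers have to be distinct, as a register that is listed twice would get the symbol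
twice. -/
theorem runOps_save {sv : List X} (hsv : sv.Nodup) (a : Γ') (p : Parse) (e : E) (o : List Γ')
    (v : Fin 3 → Var) (r : X → List Γ') :
    runOps (sv.map fun x => .push (.inr x) a) (readMem p e o v r) =
      readMem p e o v (saved sv [a] r) := by
  induction sv generalizing r with
  | nil => simp [runOps]
  | cons x sv ih =>
    have hx : x ∉ sv := (List.nodup_cons.1 hsv).1
    have h : Op.run (.push (.inr x) a) (readMem p e o v r) =
        readMem p e o v (Function.update r x (a :: r x)) := by
      simp only [Op.run, readMem, Mem.mk.injEq, true_and, Sum.elim_inr]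
      funext k
      rcases k with k | k
      · simp
      · by_cases hk : k = x
        · subst hk; simp
        · simp [hk]
    change runOps (sv.map fun x => Op.push (Sum.inr x) a) (Op.run (.push (.inr x) a) _) = _
    rw [h, ih hsv.of_cons]
    congr 1
    funext k
    by_cases hk : k = x
    · subst hk; simp [saved, hx]
    · by_cases hk' : k ∈ sv <;> simp [saved, hk, hk']

variable (acts : List (Parse × E → List (Op (Parse × E) Γ' (Fin 3 ⊕ X)))) {sv : List X}
  (hsv : sv.Nodup)

include hsv

theorem runActs_readActs_sign (b : Bool) (p : Parse) (hp : p.inLit = false) (e : E) (o : List Γ')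
    (v : Fin 3 → Var) (r : X → List Γ') :
    runActs (readActs acts sv (.bit b)) (readMem p e o v r) =
      readMem (p.beginLit b) e o v (saved sv [.bit b] r) := by
  simp only [readActs, runActs, List.foldl_cons, List.foldl_nil]
  rw [runOps_save hsv]
  simp [readMem, hp, runOps, Op.run]

theorem runActs_readActs_bit (b : Bool) (p : Parse) (hp : p.inLit = true) (e : E) (o : List Γ')
    (v : Fin 3 → Var) (r : X → List Γ') :
    runActs (readActs acts sv (.bit b)) (readMem p e o v r) =
      readMem p e o (fun k => if (k : ℕ) = p.width then v k ++ [b] else v k)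
        (saved sv [.bit b] r) := by
  simp only [readActs, runActs, List.foldl_cons, List.foldl_nil]
  rw [runOps_save hsv]
  simp only [readMem, hp, if_true]
  by_cases h : (p.width : ℕ) < 3
  · refine (congrArg (fun l => runOps l _) (dif_pos h)).trans ?_
    simp only [runOps, List.foldl_cons, List.foldl_nil, Op.run, Mem.mk.injEq, true_and]
    funext k
    rcases k with k | k
    · by_cases hk : (k : ℕ) = p.width
      · obtain rfl : k = ⟨p.width, h⟩ := Fin.ext hk
        simp
      · have : k ≠ ⟨p.width, h⟩ := fun h' => hk (congrArg Fin.val h')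
        simp [hk, this]
    · simp
  · refine (congrArg (fun l => runOps l _) (dif_neg h)).trans ?_
    simp only [runOps, List.foldl_nil, Mem.mk.injEq, true_and]
    congr 1
    funext k
    have : (k : ℕ) ≠ p.width := by omega
    simp [this]

theorem foldl_readActs_bits (w : List Bool) (p : Parse) (hp : p.inLit = true) (e : E) (o : List Γ')
    (v : Fin 3 → Var) (r : X → List Γ') :
    (w.map Γ'.bit).foldl (fun m a => runActs (readActs acts sv a) m) (readMem p e o v r) =
      readMem p e o (fun k => if (k : ℕ) = p.width then v k ++ w else v k)
        (saved sv (w.map Γ'.bit) r) := by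
  induction w generalizing v r with
  | nil => simp
  | cons b w ih =>
    simp only [List.map_cons, List.foldl_cons]
    rw [runActs_readActs_bit acts hsv b p hp, ih, ← saved_append]
    congr 1
    funext k
    split_ifs <;> simp

theorem foldl_readActs_literals (C : Clause) (e : E) (o : List Γ') (r : X → List Γ') :
    (C.flatMap encodeLiteral).foldl (fun m a => runActs (readActs acts sv a) m) (idle e o r) =
      readMem (Parse.ofClause C) e o (name C) (saved sv (C.flatMap encodeLiteral) r) := by
  induction C using List.reverseRecOn with
  | nil =>
    have h : Parse.ofClause [] = Parse.init := rfl
    simp [idle, h]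
    rfl
  | append_singleton C l ih =>
    rw [List.flatMap_append, List.foldl_append, ih]
    simp only [List.flatMap_singleton, encodeLiteral, List.foldl_append, List.cons_append,
      List.foldl_cons, List.foldl_nil]
    rw [runActs_readActs_sign acts hsv _ _ rfl, foldl_readActs_bits acts hsv _ _ rfl]
    simp only [readActs, runActs, List.foldl_cons, List.foldl_nil]
    rw [runOps_save hsv]
    simp only [readMem, runOps, Op.run, List.foldl_cons, List.foldl_nil, Mem.mk.injEq,
      Prod.mk.injEq, true_and, and_true]
    refine ⟨?_, ?_⟩
    · simp only [Parse.ofClause, Parse.beginLit, Parse.endLit, Parse.mk.injEq, true_and,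
        List.length_append, List.length_singleton]
      refine ⟨Fin.ext (by simp only []; omega), ?_⟩
      funext k
      have hk := k.2
      change (if (k : ℕ) = min C.length 4 then l.2 else sgn C k) = _
      simp only [sgn]
      rcases lt_trichotomy (k : ℕ) C.length with h | h | h
      · rw [List.getElem?_append_left h, if_neg (by omega)]
      · rw [List.getElem?_append_right h.ge, if_pos (by omega), h]
        simp
      · rw [List.getElem?_eq_none h.le, List.getElem?_eq_none (by simp; omega),
          if_neg (by omega)]
    · rw [← saved_append, ← saved_append, ← saved_append]
      congr 1
      · funext k
        have hk := k.2
        refine congrArg (fun w : Var => (w.map Γ'.bit).reverse) ?_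
        change (if (k : ℕ) = min C.length 4 then name C k ++ l.1 else name C k) = _
        simp only [name]
        rcases lt_trichotomy (k : ℕ) C.length with h | h | h
        · rw [List.getElem?_append_left h, if_neg (by omega)]
        · rw [List.getElem?_append_right h.ge, if_pos (by omega), h]
          simp
        · rw [List.getElem?_eq_none h.le, List.getElem?_eq_none (by simp; omega),
            if_neg (by omega)]

theorem foldl_readActs_clause (C : Clause) (e : E) (o : List Γ') (r : X → List Γ') {e' : E}
    {o' : List Γ'} {r' : X → List Γ'}
    (h : runActs acts (readMem (Parse.ofClause C) e o (name C) (saved sv (encodeClause C) r)) =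
      readMem (Parse.ofClause C) e' o' (name C) r') :
    (encodeClause C).foldl (fun m a => runActs (readActs acts sv a) m) (idle e o r) =
      idle e' o' r' := by
  rw [encodeClause, List.foldl_append, foldl_readActs_literals acts hsv]
  simp only [readActs, runActs, List.foldl_cons, List.foldl_nil, List.foldl_append]
  rw [runOps_save hsv, ← saved_append]
  rw [encodeClause, runActs] at h
  rw [h]
  simp only [readMem, idle, runOps, List.foldl_cons, List.foldl_nil, Op.run, Mem.mk.injEq, true_and]
  funext k
  rcases k with k | k
  · have hk : k = 0 ∨ k = 1 ∨ k = 2 := by omega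
    rcases hk with rfl | rfl | rfl <;>
      simp only [Function.update_apply, Sum.inl.injEq, Fin.reduceEq, if_true, if_false,
        List.map_nil, List.reverse_nil, Sum.elim_inl]
  · simp only [Function.update_apply, reduceCtorEq, if_false, Sum.elim_inr]

/-- A clause reader computes a fold over the clauses of the formula, if its actions at the end of
a clause perform the step of the fold on a representation `rep` of the states. -/
theorem foldl_readActs_formula {S : Type} (rep : S → E × List Γ' × (X → List Γ'))
    (step : S → Clause → S)
    (h : ∀ s C, runActs acts (readMem (Parse.ofClause C) (rep s).1 (rep s).2.1 (name C)
        (saved sv (encodeClause C) (rep s).2.2)) =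
      readMem (Parse.ofClause C) (rep (step s C)).1 (rep (step s C)).2.1 (name C)
        (rep (step s C)).2.2) (φ : Formula) (s : S) :
    (encodeFormula φ).foldl (fun m a => runActs (readActs acts sv a) m)
        (idle (rep s).1 (rep s).2.1 (rep s).2.2) =
      idle (rep (φ.foldl step s)).1 (rep (φ.foldl step s)).2.1 (rep (φ.foldl step s)).2.2 := by
  induction φ generalizing s with
  | nil => rfl
  | cons C φ ih =>
    rw [encodeFormula, List.flatMap_cons, List.foldl_append,
      foldl_readActs_clause acts hsv C _ _ _ (h s C)]
    exact ih _

end Reader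

/-! ### The gadget formula -/

/-- A symbolic variable of a block: the variable of the `i`-th literal of the clause of the block,
or the auxiliary variable with tag `j` and the index of the block, increased by one if `d` holds. -/
inductive SVar : Type
  | lit (i : Fin 3)
  | aux (j : ℕ) (d : Bool)
  deriving DecidableEq

/-- A symbolic literal. For a literal of the clause of the block, the second component tells
whether it is that literal itself or its negation. -/
abbrev SLit : Type := SVar × Bool

/-- The auxiliary variable with tag `j` and index `n`. -/
def auxVar (j n : ℕ) : Var :=
  false :: (List.replicate j true ++ false :: List.replicate n true)

/-- The literal that a symbolic literal denotes in the block with index `n` and clause `C`. -/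
def instLit (n : ℕ) (C : Clause) : SLit → Literal
  | (.lit i, p) => (true :: name C i, sgn C i == p)
  | (.aux j d, p) => (auxVar j (n + d.toNat), p)

/-- The clauses that a list of symbolic clauses denotes. -/
def instAll (n : ℕ) (C : Clause) (T : List (List SLit)) : Formula :=
  T.map fun t => t.map (instLit n C)

/-- The clause `a ∨ b ∨ c ∨ d`, split into two clauses by means of an auxiliary variable that
belongs to the number `k`. -/
def pair (k : ℕ) (a b c d : SLit) : List (List SLit) :=
  [[(.aux (k + 5) false, true), a, b], [(.aux (k + 5) false, false), c, d]]

/-- The symbolic clauses at the end of the chain, which say that `v → ¬ c` and `v → u`. The tags of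
the chain variables `u`, `v`, `c` are 0, 1, 2. -/
def endT : List (List SLit) :=
  let u : SVar := .aux 0 false
  let v : SVar := .aux 1 false
  let c : SVar := .aux 2 false
  pair 12 (v, false) (c, false) (v, false) (c, false) ++
  pair 13 (v, false) (u, true) (v, false) (u, true)

/-- The symbolic clauses of a block with the clause `l₀ ∨ l₁ ∨ l₂`. The tags of the selector `s` and
of the escape variable `e` are 3 and 4, and a prime marks the chain variables with the next index.
The pairs, with the numbers from 0 to 9, say that `u' → u ∨ s`, `v → v' ∨ s`, `l₀ ∨ l₁ ∨ l₂ ∨ e`,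
`e → u ∨ v'`, `s → ¬ lᵢ` for each `i`, `s → c'`, `c → c'`, and `s → ¬ c`. A disjunction of two
literals is written twice to get four. -/
def blockT : List (List SLit) :=
  let u : SVar := .aux 0 false
  let v : SVar := .aux 1 false
  let c : SVar := .aux 2 false
  let u' : SVar := .aux 0 true
  let v' : SVar := .aux 1 true
  let c' : SVar := .aux 2 true
  let s : SVar := .aux 3 false
  let e : SVar := .aux 4 false
  pair 0 (u', false) (u, true) (u', false) (s, true) ++
  pair 1 (v, false) (v', true) (v, false) (s, true) ++
  pair 2 (.lit 0, true) (.lit 1, true) (.lit 2, true) (e, true) ++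
  pair 3 (e, false) (u, true) (e, false) (v', true) ++
  pair 4 (s, false) (.lit 0, false) (s, false) (.lit 0, false) ++
  pair 5 (s, false) (.lit 1, false) (s, false) (.lit 1, false) ++
  pair 6 (s, false) (.lit 2, false) (s, false) (.lit 2, false) ++
  pair 7 (s, false) (c', true) (s, false) (c', true) ++
  pair 8 (c, false) (c', true) (c, false) (c', true) ++
  pair 9 (s, false) (c, false) (s, false) (c, false)

/-- The symbolic clauses at the start of the chain, which say that `u → c` and `u → v`. -/
def startT : List (List SLit) :=
  let u : SVar := .aux 0 false
  let v : SVar := .aux 1 false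
  let c : SVar := .aux 2 false
  pair 10 (c, true) (u, false) (c, true) (u, false) ++
  pair 11 (v, true) (u, false) (v, true) (u, false)

/-- All symbolic clauses. A position in this list is the kind of a clause of the gadget formula:
the kinds below 4 belong to the end of the chain, those from 24 on to its start, and the others to
the blocks. -/
def templates : List (List SLit) := endT ++ blockT ++ startT

/-- The symbolic clause of a given kind. -/
def template (t : Fin 28) : List SLit := templates.getD t []

/-! ### Symbolic assignments -/

/-- Whether a kind belongs to the blocks. -/
def inBlock (t : Fin 28) : Bool := decide (4 ≤ t.val) && decide (t.val < 24)

/-- The kind of the first clause of the pair with number `k`. -/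
def pairPos (k : ℕ) : ℕ :=
  if k < 10 then 4 + 2 * k else if k < 12 then 24 + 2 * (k - 10) else 2 * (k - 12)

/-- The number of the pair to which a kind belongs. -/
def pairOf (t : Fin 28) : ℕ :=
  if t.val < 4 then t.val / 2 + 12 else if t.val < 24 then (t.val - 4) / 2
  else (t.val - 24) / 2 + 10

/-- The value of the chain variable with tag `j` at the indices up to that of the block with the
missing clause, where `κ` is the kind of this clause. The values of `u`, `v`, `c` form one of the
triples 111, 110, 101 and 010. The start of the chain admits 111 and 010, and its end admits 101 and
110, so that the triple has to change at the missing clause unless this is a clause of an end. -/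
def lowVal (κ : Fin 28) (j : ℕ) : Bool :=
  if pairOf κ ∈ [1, 8, 9, 12] then true
  else if pairOf κ = 10 then j != 2
  else if pairOf κ = 11 then j != 1
  else j == 1

/-- The value of the chain variable with tag `j` at the indices above that of the block with the
missing clause, where `κ` is the kind of this clause. -/
def highVal (κ : Fin 28) (j : ℕ) : Bool :=
  if pairOf κ = 12 then true
  else if pairOf κ ∈ [0, 7, 8, 10] then j != 2
  else if pairOf κ = 13 then j == 1
  else j != 1

/-- The value of a symbolic variable other than the splitting variables if a clause of kind `κ` is
missing. The phase `h` is 0, 1 or 2 if the index of the block is above, equal to or below that of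
the block with the missing clause. -/
def baseVal (κ : Fin 28) (h : Fin 3) : SVar → Bool
  | .lit i => pairOf κ == 4 + i
  | .aux j d =>
    if j < 3 then if h = 0 ∨ h = 1 ∧ d = true then highVal κ j else lowVal κ j
    else if j = 3 then decide (h = 1) && decide (pairOf κ ∈ [2, 3, 4, 5, 6, 7, 9])
    else !(decide (h = 1) && decide (pairOf κ ∈ [2, 4, 5, 6]))

/-- Whether a symbolic literal is known to be true, with the values `val` of the symbolic variables.
The literals of the clause of a block are only known in phase 1. -/
def certOf (val : SVar → Bool) (h : Fin 3) : SLit → Bool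
  | (.lit i, p) => decide (h = 1) && (val (.lit i) == p)
  | (.aux j d, p) => val (.aux j d) == p

/-- The value of a symbolic variable. A splitting variable is true if the first clause of its pair
needs it, unless this is the missing clause. -/
def symVal (κ : Fin 28) (h : Fin 3) : SVar → Bool
  | .lit i => baseVal κ h (.lit i)
  | .aux j d =>
    if j < 5 then baseVal κ h (.aux j d)
    else
      ((templates.getD (pairPos (j - 5)) []).tail.all fun l => !certOf (baseVal κ h) h l) &&
      !(decide (κ.val = pairPos (j - 5)) && decide (h = 1 ∨ 15 ≤ j))

/-- The phase that is used for the clauses of kind `t`. The end of the chain has the largest index,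
and its start the smallest. If the missing clause does not belong to a block, then the chain
variables are constant, and the phase 0 is used for all blocks. -/
def effPhase (κ t : Fin 28) (h : Fin 3) : Fin 3 :=
  if t.val < 4 then 0 else if 24 ≤ t.val then 2 else if inBlock κ then h else 0

set_option maxRecDepth 100000 in
/-- Every clause that is not missing contains a literal that is known to be true. A clause that has
the kind of the missing one is present if it belongs to another block. As the values are symbolic,
this is a finite check, which does not depend on the given formula. -/
theorem exists_cert (κ t : Fin 28) (h : Fin 3)
    (ht : t ≠ κ ∨ inBlock κ = true ∧ h ≠ 1) :
    ∃ l ∈ template t, certOf (symVal κ (effPhase κ t h)) (effPhase κ t h) l = true := by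
  revert κ t h
  decide +kernel

/-- The clauses of the blocks for a list of clauses, where the last clause has the index 0. -/
def blocks : List Clause → Formula
  | [] => []
  | C :: G => instAll G.length C blockT ++ blocks G

/-- The gadget formula for a list of clauses. -/
def gadget (G : List Clause) : Formula :=
  instAll G.length [] endT ++ (blocks G ++ instAll 0 [] startT)

/-! ### The gadget formula is as satisfiable as the given formula -/

theorem satisfies_append {τ : Var → Bool} {φ ψ : Formula} :
    Satisfies τ (φ ++ ψ) ↔ Satisfies τ φ ∧ Satisfies τ ψ := by
  simp only [Satisfies, List.mem_append, or_imp, forall_and]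

theorem instAll_append (n : ℕ) (C : Clause) (T T' : List (List SLit)) :
    instAll n C (T ++ T') = instAll n C T ++ instAll n C T' := by
  simp [instAll]

/-- The truth of a symbolic literal. -/
def Holds (τ : Var → Bool) (n : ℕ) (C : Clause) (l : SLit) : Prop :=
  τ (instLit n C l).1 = (instLit n C l).2

theorem satisfies_instAll {τ : Var → Bool} {n : ℕ} {C : Clause} {T : List (List SLit)} :
    Satisfies τ (instAll n C T) ↔ ∀ t ∈ T, ∃ l ∈ t, Holds τ n C l := by
  simp only [Satisfies, instAll, List.forall_mem_map]
  refine forall₂_congr fun t _ => ?_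
  simp only [List.mem_map, exists_exists_and_eq_and, Holds]

theorem satisfies_pair {τ : Var → Bool} {n : ℕ} {C : Clause} {k : ℕ} {a b c d : SLit} :
    Satisfies τ (instAll n C (pair k a b c d)) ↔
      (τ (auxVar (k + 5) n) = true ∨ Holds τ n C a ∨ Holds τ n C b) ∧
      (τ (auxVar (k + 5) n) = false ∨ Holds τ n C c ∨ Holds τ n C d) := by
  simp only [satisfies_instAll, pair, List.mem_cons, List.not_mem_nil, or_false, exists_eq_or_imp,
    exists_eq_left, forall_eq_or_imp, forall_eq]
  rfl

theorem or_of_satisfies_pair {τ : Var → Bool} {n : ℕ} {C : Clause} {k : ℕ} {a b c d : SLit}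
    (h : Satisfies τ (instAll n C (pair k a b c d))) :
    Holds τ n C a ∨ Holds τ n C b ∨ Holds τ n C c ∨ Holds τ n C d := by
  rw [satisfies_pair] at h
  cases hk : τ (auxVar (k + 5) n) <;> simp [hk] at h <;> tauto

@[simp]
theorem holds_aux_true {τ : Var → Bool} {n : ℕ} {C : Clause} {j : ℕ} {d : Bool} :
    Holds τ n C (.aux j d, true) ↔ τ (auxVar j (n + d.toNat)) = true := Iff.rfl

@[simp]
theorem holds_aux_false {τ : Var → Bool} {n : ℕ} {C : Clause} {j : ℕ} {d : Bool} :
    Holds τ n C (.aux j d, false) ↔ ¬ τ (auxVar j (n + d.toNat)) = true := by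
  rw [Bool.not_eq_true]; exact Iff.rfl

theorem holds_lit_true {τ : Var → Bool} {n : ℕ} {C : Clause} {i : Fin 3} :
    Holds τ n C (.lit i, true) ↔ τ (true :: name C i) = sgn C i := by
  simp [Holds, instLit]

theorem holds_lit_false {τ : Var → Bool} {n : ℕ} {C : Clause} {i : Fin 3} :
    Holds τ n C (.lit i, false) ↔ ¬ Holds τ n C (.lit i, true) := by
  rw [holds_lit_true]
  simp [Holds, instLit, Bool.eq_not]

theorem exists_mem_iff_lits {τ : Var → Bool} {n : ℕ} {C : Clause} (hC : C.length = 3) :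
    (∃ l ∈ C, τ (true :: l.1) = l.2) ↔
      Holds τ n C (.lit 0, true) ∨ Holds τ n C (.lit 1, true) ∨ Holds τ n C (.lit 2, true) := by
  obtain ⟨l₀, l₁, l₂, rfl⟩ := List.length_eq_three.1 hC
  simp [holds_lit_true, name, sgn]

/-- The reason why the chain of a gadget formula enforces all clauses: `c n` implies that some
selector below `n` is true, and no two selectors can be true, but a false clause needs two
selectors, or a selector and one end of the chain. -/
theorem chain_forces {m : ℕ} {u v c s e L : ℕ → Prop}
    (hA : ∀ n < m, u (n + 1) → u n ∨ s n) (hB : ∀ n < m, v n → v (n + 1) ∨ s n)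
    (hD : ∀ n < m, L n ∨ e n) (hH : ∀ n < m, e n → u n ∨ v (n + 1))
    (hN : ∀ n < m, s n → ¬ L n) (hE : ∀ n < m, s n → c (n + 1))
    (hF : ∀ n < m, c n → c (n + 1)) (hG : ∀ n < m, s n → ¬ c n)
    (hs : u 0 → c 0 ∧ v 0) (he : v m → ¬ c m ∧ u m) : ∀ n < m, L n := by
  have hc : ∀ a b, a ≤ b → b ≤ m → c a → c b := by
    intro a b hab
    induction b, hab using Nat.le_induction with
    | base => exact fun _ h => h
    | succ b hb ih => exact fun hm h => hF b (by omega) (ih (by omega) h)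
  -- If `u 0` holds, then `c 0` excludes all selectors, so that `v 0` carries over to `v m`.
  have hu₀ : ¬ u 0 := by
    intro h
    obtain ⟨h₁, h₂⟩ := hs h
    have hv : ∀ k ≤ m, v k := by
      intro k hk
      induction k with
      | zero => exact h₂
      | succ k ih =>
        exact (hB k hk (ih (by omega))).resolve_right fun h =>
          hG k hk h (hc 0 k (by omega) (by omega) h₁)
    exact (he (hv m le_rfl)).1 (hc 0 m (by omega) le_rfl h₁)
  have hu : ∀ k ≤ m, u k → ∃ q < k, s q := by
    intro k hk
    induction k with
    | zero => exact fun h => absurd h hu₀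
    | succ k ih =>
      intro h
      rcases hA k hk h with h | h
      · obtain ⟨q, hq, h⟩ := ih (by omega) h
        exact ⟨q, by omega, h⟩
      · exact ⟨k, by omega, h⟩
  -- If `v m` holds, then `u m` yields a selector, which forces `c m`.
  have hvm : ¬ v m := by
    intro h
    obtain ⟨h₁, h₂⟩ := he h
    obtain ⟨q, hq, h⟩ := hu m le_rfl h₂
    exact h₁ (hc (q + 1) m hq le_rfl (hE q hq h))
  have hv : ∀ d k, k + d = m → v k → ∃ q, k ≤ q ∧ q < m ∧ s q := by
    intro d
    induction d with
    | zero => rintro k rfl h; exact absurd h hvm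
    | succ d ih =>
      intro k hk h
      rcases hB k (by omega) h with h | h
      · obtain ⟨q, hq, hqm, h⟩ := ih (k + 1) (by omega) h
        exact ⟨q, by omega, hqm, h⟩
      · exact ⟨k, le_rfl, by omega, h⟩
  -- The escape from the false clause of a selected block leads to a second selector.
  have hs : ∀ n < m, ¬ s n := by
    intro n hn h
    rcases hH n hn ((hD n hn).resolve_left (hN n hn h)) with h' | h'
    · obtain ⟨q, hq, h'⟩ := hu n hn.le h'
      exact hG n hn h (hc (q + 1) n hq hn.le (hE q (by omega) h'))
    · obtain ⟨q, hq, hqm, h'⟩ := hv (m - (n + 1)) (n + 1) (by omega) h'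
      exact hG q hqm h' (hc (n + 1) q hq hqm.le (hE n hn h))
  intro n hn
  refine (hD n hn).resolve_right fun h => ?_
  rcases hH n hn h with h' | h'
  · obtain ⟨q, hq, h'⟩ := hu n hn.le h'
    exact hs q (by omega) h'
  · obtain ⟨q, hq, hqm, h'⟩ := hv (m - (n + 1)) (n + 1) (by omega) h'
    exact hs q hqm h'

theorem satisfies_blocks {τ : Var → Bool} {G : List Clause} :
    Satisfies τ (blocks G) ↔
      ∀ G₁ C G₂, G = G₁ ++ C :: G₂ → Satisfies τ (instAll G₂.length C blockT) := by
  induction G with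
  | nil => simp [blocks, Satisfies]
  | cons C G ih =>
    rw [blocks, satisfies_append, ih]
    constructor
    · rintro ⟨h₁, h₂⟩ G₁ C' G₂ h
      rcases List.cons_eq_append_iff.1 h with ⟨rfl, h⟩ | ⟨G', rfl, rfl⟩
      · obtain ⟨rfl, rfl⟩ := List.cons_eq_cons.1 h.symm
        exact h₁
      · exact h₂ _ _ _ rfl
    · exact fun h => ⟨h [] C G rfl, fun G₁ C' G₂ h' => h (C :: G₁) C' G₂ (by rw [h']; rfl)⟩

/-- The implications that the clauses of a block express. -/
theorem block_facts {τ : Var → Bool} {n : ℕ} {C : Clause} (hC : C.length = 3)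
    (h : Satisfies τ (instAll n C blockT)) :
    (τ (auxVar 0 (n + 1)) = true → τ (auxVar 0 n) = true ∨ τ (auxVar 3 n) = true) ∧
    (τ (auxVar 1 n) = true → τ (auxVar 1 (n + 1)) = true ∨ τ (auxVar 3 n) = true) ∧
    ((∃ l ∈ C, τ (true :: l.1) = l.2) ∨ τ (auxVar 4 n) = true) ∧
    (τ (auxVar 4 n) = true → τ (auxVar 0 n) = true ∨ τ (auxVar 1 (n + 1)) = true) ∧
    (τ (auxVar 3 n) = true → ¬ ∃ l ∈ C, τ (true :: l.1) = l.2) ∧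
    (τ (auxVar 3 n) = true → τ (auxVar 2 (n + 1)) = true) ∧
    (τ (auxVar 2 n) = true → τ (auxVar 2 (n + 1)) = true) ∧
    (τ (auxVar 3 n) = true → ¬ τ (auxVar 2 n) = true) := by
  simp only [blockT, instAll_append, satisfies_append] at h
  obtain ⟨⟨⟨⟨⟨⟨⟨⟨⟨hA, hB⟩, hD⟩, hH⟩, hN₀⟩, hN₁⟩, hN₂⟩, hE⟩, hF⟩, hG⟩ := h
  have hA := or_of_satisfies_pair hA
  have hB := or_of_satisfies_pair hB
  have hD := or_of_satisfies_pair hD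
  have hH := or_of_satisfies_pair hH
  have hN₀ := or_of_satisfies_pair hN₀
  have hN₁ := or_of_satisfies_pair hN₁
  have hN₂ := or_of_satisfies_pair hN₂
  have hE := or_of_satisfies_pair hE
  have hF := or_of_satisfies_pair hF
  have hG := or_of_satisfies_pair hG
  rw [exists_mem_iff_lits (n := n) hC]
  simp only [holds_aux_true, holds_aux_false, holds_lit_false, Bool.toNat_false, Bool.toNat_true,
    add_zero] at hA hB hD hH hN₀ hN₁ hN₂ hE hF hG
  refine ⟨?_, ?_, ?_, ?_, ?_, ?_, ?_, ?_⟩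
  · clear hB hD hH hN₀ hN₁ hN₂ hE hF hG; tauto
  · clear hA hD hH hN₀ hN₁ hN₂ hE hF hG; tauto
  · clear hA hB hH hN₀ hN₁ hN₂ hE hF hG; tauto
  · clear hA hB hD hN₀ hN₁ hN₂ hE hF hG; tauto
  · clear hA hB hD hH hE hF hG; tauto
  · clear hA hB hD hH hN₀ hN₁ hN₂ hF hG; tauto
  · clear hA hB hD hH hN₀ hN₁ hN₂ hE hG; tauto
  · clear hA hB hD hH hN₀ hN₁ hN₂ hE hF; tauto

theorem end_facts {τ : Var → Bool} {n : ℕ} {C : Clause} (h : Satisfies τ (instAll n C endT)) :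
    τ (auxVar 1 n) = true → ¬ τ (auxVar 2 n) = true ∧ τ (auxVar 0 n) = true := by
  simp only [endT, instAll_append, satisfies_append] at h
  have h₁ := or_of_satisfies_pair h.1
  have h₂ := or_of_satisfies_pair h.2
  simp only [holds_aux_true, holds_aux_false, Bool.toNat_false, add_zero] at h₁ h₂
  tauto

theorem start_facts {τ : Var → Bool} {n : ℕ} {C : Clause} (h : Satisfies τ (instAll n C startT)) :
    τ (auxVar 0 n) = true → τ (auxVar 2 n) = true ∧ τ (auxVar 1 n) = true := by
  simp only [startT, instAll_append, satisfies_append] at h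
  have h₁ := or_of_satisfies_pair h.1
  have h₂ := or_of_satisfies_pair h.2
  simp only [holds_aux_true, holds_aux_false, Bool.toNat_false, add_zero] at h₁ h₂
  tauto

/-- A satisfying assignment of the gadget formula restricts to one of the given formula. -/
theorem satisfies_of_satisfies_gadget {G : List Clause} (hG : ∀ C ∈ G, C.length = 3)
    {τ : Var → Bool} (h : Satisfies τ (gadget G)) : Satisfies (fun x => τ (true :: x)) G := by
  rw [gadget, satisfies_append, satisfies_append, satisfies_blocks] at h
  obtain ⟨hend, hbl, hstart⟩ := h
  have hC : ∀ n < G.length, ∃ C, (∃ G₁ G₂, G = G₁ ++ C :: G₂ ∧ G₂.length = n) ∧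
      C.length = 3 ∧ Satisfies τ (instAll n C blockT) := by
    intro n hn
    have hdec : G = G.take (G.length - 1 - n) ++ G[G.length - 1 - n] ::
        G.drop (G.length - 1 - n + 1) := by
      rw [List.getElem_cons_drop, List.take_append_drop]
    have hlen : (G.drop (G.length - 1 - n + 1)).length = n := by
      rw [List.length_drop]; omega
    refine ⟨_, ⟨_, _, hdec, hlen⟩, hG _ (List.getElem_mem _), ?_⟩
    have := hbl _ _ _ hdec
    rwa [hlen] at this
  choose! c hc h3 hs using hC
  have hall := chain_forces (m := G.length) (u := fun n => τ (auxVar 0 n) = true)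
    (v := fun n => τ (auxVar 1 n) = true) (c := fun n => τ (auxVar 2 n) = true)
    (s := fun n => τ (auxVar 3 n) = true) (e := fun n => τ (auxVar 4 n) = true)
    (L := fun n => ∃ l ∈ c n, τ (true :: l.1) = l.2)
    (fun n hn => (block_facts (h3 n hn) (hs n hn)).1)
    (fun n hn => (block_facts (h3 n hn) (hs n hn)).2.1)
    (fun n hn => (block_facts (h3 n hn) (hs n hn)).2.2.1)
    (fun n hn => (block_facts (h3 n hn) (hs n hn)).2.2.2.1)
    (fun n hn => (block_facts (h3 n hn) (hs n hn)).2.2.2.2.1)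
    (fun n hn => (block_facts (h3 n hn) (hs n hn)).2.2.2.2.2.1)
    (fun n hn => (block_facts (h3 n hn) (hs n hn)).2.2.2.2.2.2.1)
    (fun n hn => (block_facts (h3 n hn) (hs n hn)).2.2.2.2.2.2.2)
    (start_facts hstart) (end_facts hend)
  intro C hC
  obtain ⟨G₁, G₂, h⟩ := List.append_of_mem hC
  have hn : G₂.length < G.length := by rw [h]; simp; omega
  obtain ⟨G₁', G₂', h', hl⟩ := hc _ hn
  have := (List.append_inj' (h.symm.trans h') (by simp [hl])).2
  rw [(List.cons_eq_cons.1 this).1]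
  exact hall _ hn

theorem auxVar_inj {j n j' n' : ℕ} : auxVar j n = auxVar j' n' ↔ j = j' ∧ n = n' := by
  refine ⟨fun h => ?_, by rintro ⟨rfl, rfl⟩; rfl⟩
  have h' : List.replicate j true ++ false :: List.replicate n true =
      List.replicate j' true ++ false :: List.replicate n' true := (List.cons_eq_cons.1 h).2
  clear h
  induction j generalizing j' with
  | zero =>
    cases j' with
    | zero => simpa using congrArg List.length h'
    | succ j' => simp [List.replicate_succ] at h'
  | succ j ih =>
    cases j' with
    | zero => simp [List.replicate_succ] at h'
    | succ j' =>
      have := ih (j' := j') (by simpa [List.replicate_succ] using h')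
      omega

open Classical in
/-- The extension of an assignment to the gadget formula. All auxiliary variables are false, except
those that split a clause whose first two literals are false. -/
noncomputable def extend (τ : Var → Bool) (G : List Clause) : Var → Bool
  | true :: x => τ x
  | x => decide (∃ G₁ C G₂, G = G₁ ++ C :: G₂ ∧ x = auxVar 7 G₂.length ∧
      τ (name C 0) ≠ sgn C 0 ∧ τ (name C 1) ≠ sgn C 1)

open Classical in
theorem extend_auxVar {τ : Var → Bool} {G : List Clause} {j n : ℕ} :
    extend τ G (auxVar j n) = true ↔ j = 7 ∧ ∃ G₁ C G₂, G = G₁ ++ C :: G₂ ∧ n = G₂.length ∧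
      τ (name C 0) ≠ sgn C 0 ∧ τ (name C 1) ≠ sgn C 1 := by
  have h : extend τ G (auxVar j n) = true ↔ ∃ G₁ C G₂, G = G₁ ++ C :: G₂ ∧
      auxVar j n = auxVar 7 G₂.length ∧ τ (name C 0) ≠ sgn C 0 ∧ τ (name C 1) ≠ sgn C 1 :=
    decide_eq_true_iff
  simp only [h, auxVar_inj]
  grind

/-- With all chain variables, selectors and escape variables false, only the clauses themselves
remain to be satisfied. -/
theorem satisfies_gadget {G : List Clause} (hG : ∀ C ∈ G, C.length = 3) {τ : Var → Bool}
    (h : Satisfies τ G) : Satisfies (extend τ G) (gadget G) := by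
  have hx : ∀ {j n}, j ≠ 7 → extend τ G (auxVar j n) = false := by
    intro j n hj
    rw [← Bool.not_eq_true, extend_auxVar]
    exact fun h => hj h.1
  rw [gadget, satisfies_append, satisfies_append, satisfies_blocks]
  refine ⟨?_, ?_, ?_⟩
  · simp [endT, instAll_append, satisfies_append, satisfies_pair, hx]
  · rintro G₁ C G₂ rfl
    have h3 := hG C (by simp)
    have hL : ∃ l ∈ C, extend τ (G₁ ++ C :: G₂) (true :: l.1) = l.2 := h C (by simp)
    rw [exists_mem_iff_lits (n := G₂.length) h3] at hL
    have h7 : extend τ (G₁ ++ C :: G₂) (auxVar 7 G₂.length) = true ↔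
        τ (name C 0) ≠ sgn C 0 ∧ τ (name C 1) ≠ sgn C 1 := by
      rw [extend_auxVar]
      refine ⟨?_, fun h => ⟨rfl, G₁, C, G₂, rfl, rfl, h⟩⟩
      rintro ⟨-, G₁', C', G₂', h, hl, h'⟩
      have := (List.append_inj' h (by simp [hl])).2
      rw [(List.cons_eq_cons.1 this).1]
      exact h'
    simp only [blockT, instAll_append, satisfies_append, satisfies_pair, holds_aux_true,
      holds_aux_false]
    simp only [hx, Nat.reduceAdd, ne_eq, Nat.reduceEqDiff, not_false_eq_true,
      Bool.false_eq_true, or_false, true_or, or_true, true_and, and_true, OfNat.zero_ne_ofNat,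
      OfNat.one_ne_ofNat]
    simp only [holds_lit_true] at hL ⊢
    rw [← Bool.not_eq_true, h7]
    change τ _ = _ ∨ τ _ = _ ∨ τ _ = _ at hL
    change (_ ∨ τ _ = _ ∨ τ _ = _) ∧ (_ ∨ τ _ = _)
    tauto
  · simp [startT, instAll_append, satisfies_append, satisfies_pair, hx]

/-! ### The reduction -/

/-- Whether a clause does not consist of three distinct literals. -/
def isBad (C : Clause) : Bool := decide (C.length ≠ 3 ∨ ¬ C.Nodup)

/-- Whether a clause contains a variable together with its negation. -/
def isTaut (C : Clause) : Bool := decide (∃ l ∈ C, (l.1, !l.2) ∈ C)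

/-- One step of the reduction. The state tells whether a clause has been read, and it consists of
the number of the blocks and the formula that have been produced. -/
def redStep (s : Bool × ℕ × Formula) (C : Clause) : Bool × ℕ × Formula :=
  (true,
    if isBad C then (s.2.1, [] :: s.2.2)
    else if isTaut C then s.2
    else (s.2.1 + 1, instAll s.2.1 C blockT ++ s.2.2))

/-- The state of the reduction after the whole formula has been read. -/
def redState (φ : Formula) : Bool × ℕ × Formula :=
  φ.foldl redStep (false, 0, instAll 0 [] startT)

/-- The reduction. It produces the gadget formula for the clauses that are not tautological, where
it inserts an empty clause for every clause that does not consist of three distinct literals, and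
one for an empty formula. -/
def reduction (φ : Formula) : Formula :=
  (if (redState φ).1 then [] else [[]]) ++ (instAll (redState φ).2.1 [] endT ++ (redState φ).2.2)

/-- The clauses that get a block, in the order of their blocks. -/
def relevant (φ : Formula) : List Clause := (φ.filter fun C => !isTaut C).reverse

theorem redState_fst {φ : Formula} (h : φ ≠ []) : (redState φ).1 = true := by
  obtain ⟨φ, C, rfl⟩ := List.eq_nil_or_concat' φ |>.resolve_left h
  simp [redState, redStep]

theorem nil_mem_redState {φ : Formula} (h : ∃ C ∈ φ, isBad C = true) : [] ∈ (redState φ).2.2 := by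
  induction φ using List.reverseRecOn with
  | nil => simp at h
  | append_singleton φ C ih =>
    have e : redState (φ ++ [C]) = redStep (redState φ) C := by simp [redState]
    rw [e, redStep]
    by_cases hC : isBad C = true
    · simp [hC]
    · have := ih (by
        obtain ⟨D, hD, hb⟩ := h
        rcases List.mem_append.1 hD with hD | hD
        · exact ⟨D, hD, hb⟩
        · rw [List.mem_singleton.1 hD] at hb; exact absurd hb hC)
      by_cases ht : isTaut C = true <;> simp [hC, ht, this]

theorem redState_of_forall {φ : Formula} (h : ∀ C ∈ φ, isBad C = false) :
    (redState φ).2 = ((relevant φ).length, blocks (relevant φ) ++ instAll 0 [] startT) := by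
  induction φ using List.reverseRecOn with
  | nil => rfl
  | append_singleton φ C ih =>
    have e : redState (φ ++ [C]) = redStep (redState φ) C := by simp [redState]
    have hC : isBad C = false := h C (by simp)
    have ih := ih fun D hD => h D (by simp [hD])
    rw [e, redStep]
    by_cases ht : isTaut C = true
    · simp [hC, ht, ih, relevant]
    · have hr : relevant (φ ++ [C]) = C :: relevant φ := by simp [relevant, ht]
      simp [hC, ht, ih, hr, blocks]

theorem reduction_of_mem {φ : Formula} (h : φ ∈ E3CNF) : reduction φ = gadget (relevant φ) := by
  have hb : ∀ C ∈ φ, isBad C = false := fun C hC => by simpa [isBad] using h.2 C hC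
  simp [reduction, redState_fst h.1, redState_of_forall hb, gadget]

theorem nil_mem_reduction {φ : Formula} (h : φ ∉ E3CNF) : [] ∈ reduction φ := by
  by_cases h₀ : φ = []
  · subst h₀; simp [reduction, redState]
  · have : ∃ C ∈ φ, isBad C = true := by
      by_contra! hb
      exact h ⟨h₀, fun C hC => by simpa [isBad] using hb C hC⟩
    simp [reduction, nil_mem_redState this]

theorem mem_relevant {φ : Formula} (h : φ ∈ E3CNF) {C : Clause} (hC : C ∈ relevant φ) :
    C ∈ φ ∧ C.length = 3 ∧ C.Nodup ∧ ∀ l ∈ C, (l.1, !l.2) ∉ C := by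
  simp only [relevant, List.mem_reverse, List.mem_filter, isTaut, Bool.not_eq_true',
    decide_eq_false_iff_not, not_exists, not_and] at hC
  exact ⟨hC.1, (h.2 C hC.1).1, (h.2 C hC.1).2, hC.2⟩

theorem satisfies_relevant {φ : Formula} {τ : Var → Bool} :
    Satisfies τ (relevant φ) ↔ Satisfies τ φ := by
  refine ⟨fun h C hC => ?_, fun h C hC => h C ?_⟩
  · by_cases ht : isTaut C = true
    · obtain ⟨l, hl, hl'⟩ := of_decide_eq_true ht
      rcases Bool.eq_or_eq_not (τ l.1) l.2 with e | e
      exacts [⟨l, hl, e⟩, ⟨_, hl', e⟩]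
    · exact h C (by simp [relevant, hC, ht])
  · exact (List.mem_filter.1 (List.mem_reverse.1 hC)).1

theorem instLit_injective_of_nodup {n : ℕ} {C : Clause} (h3 : C.length = 3) (hC : C.Nodup)
    {i j : Fin 3} (h : instLit n C (.lit i, true) = instLit n C (.lit j, true)) : i = j := by
  obtain ⟨l₀, l₁, l₂, rfl⟩ := List.length_eq_three.1 h3
  have hget : ∀ k : Fin 3, (name [l₀, l₁, l₂] k, sgn [l₀, l₁, l₂] k) = [l₀, l₁, l₂].get k := by
    intro k; fin_cases k <;> rfl
  have : [l₀, l₁, l₂].get i = [l₀, l₁, l₂].get j := by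
    rw [← hget, ← hget]
    simpa [instLit] using h
  exact List.nodup_iff_injective_get.1 hC this

theorem instLit_aux_ne_lit {n : ℕ} {C : Clause} {j : ℕ} {d p p' : Bool} {i : Fin 3} :
    instLit n C (.aux j d, p) ≠ instLit n C (.lit i, p') := by
  simp [instLit, auxVar]

theorem instLit_aux_inj {n : ℕ} {C : Clause} {j j' : ℕ} {d d' p p' : Bool} :
    instLit n C (.aux j d, p) = instLit n C (.aux j' d', p') ↔ j = j' ∧ d = d' ∧ p = p' := by
  simp only [instLit, Prod.mk.injEq, auxVar_inj]
  cases d <;> cases d' <;> simp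

theorem nodup_of_mem_block {n : ℕ} {C : Clause} (h3 : C.length = 3) (hC : C.Nodup) :
    ∀ D ∈ instAll n C blockT, D.length = 3 ∧ D.Nodup := by
  have h₀₁ := mt (instLit_injective_of_nodup (n := n) h3 hC (i := 0) (j := 1)) (by decide)
  simp [instAll, blockT, pair, instLit_aux_ne_lit, instLit_aux_ne_lit.symm, instLit_aux_inj, h₀₁]

theorem nodup_of_mem_end {n : ℕ} : ∀ D ∈ instAll n [] endT, D.length = 3 ∧ D.Nodup := by
  simp [instAll, endT, pair, instLit_aux_inj]

theorem nodup_of_mem_start {n : ℕ} : ∀ D ∈ instAll n [] startT, D.length = 3 ∧ D.Nodup := by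
  simp [instAll, startT, pair, instLit_aux_inj]

theorem gadget_mem {G : List Clause} (h : ∀ C ∈ G, C.length = 3 ∧ C.Nodup) :
    gadget G ∈ E3CNF := by
  refine ⟨by simp [gadget, instAll, endT, pair], fun D hD => ?_⟩
  rw [gadget, List.mem_append, List.mem_append] at hD
  rcases hD with hD | hD | hD
  · exact nodup_of_mem_end D hD
  · induction G with
    | nil => simp [blocks] at hD
    | cons C G ih =>
      rw [blocks, List.mem_append] at hD
      rcases hD with hD | hD
      · exact nodup_of_mem_block (h C (by simp)).1 (h C (by simp)).2 D hD
      · exact ih (fun C hC => h C (by simp [hC])) hD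
  · exact nodup_of_mem_start D hD

theorem reduction_mem {φ : Formula} (h : φ ∈ E3CNF) : reduction φ ∈ E3CNF := by
  rw [reduction_of_mem h]
  exact gadget_mem fun C hC => ⟨(mem_relevant h hC).2.1, (mem_relevant h hC).2.2.1⟩

/-- The reduction preserves membership in `E3SAT` both ways. The produced empty clauses settle the
formulas that do not belong to `E3CNF`. -/
theorem mem_iff_reduction_mem (φ : Formula) : φ ∈ E3SAT ↔ reduction φ ∈ E3SAT := by
  by_cases h : φ ∈ E3CNF
  · have h3 : ∀ C ∈ relevant φ, C.length = 3 := fun C hC => (mem_relevant h hC).2.1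
    constructor
    · rintro ⟨-, τ, hτ⟩
      refine ⟨reduction_mem h, extend τ (relevant φ), ?_⟩
      rw [reduction_of_mem h]
      exact satisfies_gadget h3 (satisfies_relevant.2 hτ)
    · rintro ⟨-, τ, hτ⟩
      rw [reduction_of_mem h] at hτ
      exact ⟨h, _, satisfies_relevant.1 (satisfies_of_satisfies_gadget h3 hτ)⟩
  · refine iff_of_false (fun h' => h h'.1) fun h' => ?_
    have := (h'.1.2 [] (nil_mem_reduction h)).1
    simp at this

/-! ### A machine for the reduction -/

section

variable {Q : Type}

/-- The operations that write a symbolic literal in front of the output, where `sg` are the signs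
of the literals of the clause. The registers contain the names of its variables and the index of
the block in unary. -/
def litOps (sg : Fin 3 → Bool) : SLit → List (Op Q Γ' (Fin 3 ⊕ Unit))
  | (.lit i, p) =>
    [.emit .comma, .copy (.inl i), .emit (.bit true), .emit (.bit (sg i == p))]
  | (.aux j d, p) =>
    [.emit .comma, .copy (.inr ())] ++ (List.replicate d.toNat (.emit (.bit true)) ++
      (.emit (.bit false) :: (List.replicate j (.emit (.bit true)) ++
        [.emit (.bit false), .emit (.bit p)])))

/-- The operations that write a list of symbolic clauses in front of the output. -/
def clausesOps (sg : Fin 3 → Bool) (T : List (List SLit)) : List (Op Q Γ' (Fin 3 ⊕ Unit)) :=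
  T.reverse.flatMap fun t => .emit .ket :: t.reverse.flatMap (litOps sg)

/-- The contents of the registers for a clause and the index of its block. -/
def blockRegs (n : ℕ) (C : Clause) : Fin 3 ⊕ Unit → List Γ' :=
  Sum.elim (fun k => ((name C k).map Γ'.bit).reverse)
    fun _ => List.replicate n (.bit true)

theorem runOps_append {A R : Type} [DecidableEq A] [DecidableEq R] (l l' : List (Op Q A R))
    (m : Mem Q A R) : runOps (l ++ l') m = runOps l' (runOps l m) :=
  List.foldl_append

theorem runOps_cons {A R : Type} [DecidableEq A] [DecidableEq R] (x : Op Q A R)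
    (l : List (Op Q A R)) (m : Mem Q A R) : runOps (x :: l) m = runOps l (x.run m) := rfl

theorem runOps_nil {A R : Type} [DecidableEq A] [DecidableEq R] (m : Mem Q A R) :
    runOps [] m = m := rfl

theorem runOps_replicate_emit {A R : Type} [DecidableEq A] [DecidableEq R] (k : ℕ) (a : A) (q : Q)
    (o : List A) (r : R → List A) :
    runOps (List.replicate k (.emit a)) ⟨q, o, r⟩ = ⟨q, List.replicate k a ++ o, r⟩ := by
  induction k generalizing o with
  | zero => rfl
  | succ k ih =>
    rw [List.replicate_succ, runOps_cons, List.replicate_succ']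
    simp [Op.run, ih]

/-- If the operations `g x` write the word `w x` in front of the output, then the operations for
all the elements of a list, in reverse order, write all the words. -/
theorem runOps_flatMap_reverse {A R X : Type} [DecidableEq A] [DecidableEq R]
    {g : X → List (Op Q A R)} {w : X → List A} {r : R → List A}
    (h : ∀ x q o, runOps (g x) ⟨q, o, r⟩ = ⟨q, w x ++ o, r⟩) (l : List X) (q : Q) (o : List A) :
    runOps (l.reverse.flatMap g) ⟨q, o, r⟩ = ⟨q, l.flatMap w ++ o, r⟩ := by
  induction l with
  | nil => rfl
  | cons x l ih =>
    rw [List.reverse_cons, List.flatMap_append, runOps_append, ih, List.flatMap_singleton, h,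
      List.flatMap_cons, List.append_assoc]

theorem runOps_litOps (n : ℕ) (C : Clause) (l : SLit) (q : Q) (o : List Γ') :
    runOps (litOps (sgn C) l) ⟨q, o, blockRegs n C⟩ =
      ⟨q, encodeLiteral (instLit n C l) ++ o, blockRegs n C⟩ := by
  rcases l with ⟨i | ⟨j, d⟩, p⟩
  · simp [litOps, runOps, Op.run, blockRegs, encodeLiteral, instLit]
  · simp only [litOps, runOps_append, runOps_cons, runOps_nil, Op.run, runOps_replicate_emit]
    simp [blockRegs, encodeLiteral, instLit, auxVar]
    rw [Nat.add_comm n, List.replicate_add, List.append_assoc]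

theorem runOps_clausesOps (n : ℕ) (C : Clause) (T : List (List SLit)) (q : Q) (o : List Γ') :
    runOps (clausesOps (sgn C) T) ⟨q, o, blockRegs n C⟩ =
      ⟨q, encodeFormula (instAll n C T) ++ o, blockRegs n C⟩ := by
  rw [clausesOps, runOps_flatMap_reverse (w := fun t => encodeClause (t.map (instLit n C)))]
  · simp [encodeFormula, instAll, List.flatMap_map]
  · intro t q o
    rw [runOps_cons]
    simp only [Op.run]
    rw [runOps_flatMap_reverse (runOps_litOps n C)]
    simp [encodeClause, List.flatMap_map]

end

/-- The flags of the machine for the reduction. -/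
structure RedState : Type where
  /-- Whether a clause has been read. -/
  seen : Bool
  /-- Whether the current clause contains a literal twice. -/
  dup : Bool
  /-- Whether the current clause contains a literal and its negation. -/
  taut : Bool
  deriving DecidableEq, Fintype

/-- The operation that compares two literals of the current clause. -/
def cmpOp (i j : Fin 3) : Op (Parse × RedState) Γ' (Fin 3 ⊕ Unit) :=
  .cmp (.inl i) (.inl j) fun e q =>
    (q.1, { q.2 with
      dup := q.2.dup || (e && (q.1.sign i == q.1.sign j))
      taut := q.2.taut || (e && (q.1.sign i != q.1.sign j)) })

/-- The actions at the end of a clause. -/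
def redActs : List (Parse × RedState → List (Op (Parse × RedState) Γ' (Fin 3 ⊕ Unit))) :=
  [fun _ => [cmpOp 0 1, cmpOp 0 2, cmpOp 1 2],
   fun q =>
    (if q.1.width ≠ 3 ∨ q.2.dup = true then [.emit .ket]
      else if q.2.taut = true then []
      else clausesOps q.1.sign blockT ++ [.push (.inr ()) (.bit true)]) ++
    [.upd fun q => (q.1, ⟨true, false, false⟩)]]

/-- The representation of the states of the reduction by the machine. -/
def redRep (s : Bool × ℕ × Formula) : RedState × List Γ' × (Unit → List Γ') :=
  (⟨s.1, false, false⟩, encodeFormula s.2.2, fun _ => List.replicate s.2.1 (.bit true))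

theorem bit_injective : Function.Injective Γ'.bit := fun _ _ h => by injection h

theorem isBad_eq {l₀ l₁ l₂ : Literal} :
    isBad [l₀, l₁, l₂] = (((decide (l₀.1 = l₁.1) && (l₀.2 == l₁.2)) ||
      (decide (l₀.1 = l₂.1) && (l₀.2 == l₂.2))) ||
      (decide (l₁.1 = l₂.1) && (l₁.2 == l₂.2))) := by
  rw [Bool.eq_iff_iff]
  simp [isBad, Prod.ext_iff]
  tauto

theorem isTaut_eq {l₀ l₁ l₂ : Literal} :
    isTaut [l₀, l₁, l₂] = (((decide (l₀.1 = l₁.1) && (l₀.2 != l₁.2)) ||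
      (decide (l₀.1 = l₂.1) && (l₀.2 != l₂.2))) ||
      (decide (l₁.1 = l₂.1) && (l₁.2 != l₂.2))) := by
  obtain ⟨x₀, b₀⟩ := l₀
  obtain ⟨x₁, b₁⟩ := l₁
  obtain ⟨x₂, b₂⟩ := l₂
  rw [Bool.eq_iff_iff]
  simp only [isTaut, decide_eq_true_eq, List.mem_cons, List.not_mem_nil, or_false,
    exists_eq_or_imp, exists_eq_left, Prod.mk.injEq, Bool.or_eq_true, Bool.and_eq_true,
    bne_iff_ne]
  cases b₀ <;> cases b₁ <;> cases b₂ <;> simp <;> grind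

theorem runActs_redActs (s : Bool × ℕ × Formula) (C : Clause) :
    runActs redActs (readMem (Parse.ofClause C) (redRep s).1 (redRep s).2.1 (name C)
        (saved [] (encodeClause C) (redRep s).2.2)) =
      readMem (Parse.ofClause C) (redRep (redStep s C)).1 (redRep (redStep s C)).2.1 (name C)
        (redRep (redStep s C)).2.2 := by
  have hinj : ∀ x y : Var, (x.map Γ'.bit).reverse = (y.map Γ'.bit).reverse ↔ x = y := fun x y =>
    List.reverse_injective.eq_iff.trans (List.map_injective_iff.2 bit_injective).eq_iff
  have hregs : Sum.elim (fun k => ((name C k).map Γ'.bit).reverse) (redRep s).2.2 =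
    blockRegs s.2.1 C := rfl
  rw [saved_nil_left]
  simp only [runActs, redActs, List.foldl_cons, List.foldl_nil]
  obtain ⟨d, t, h₁, h₂⟩ : ∃ d t, runOps [cmpOp 0 1, cmpOp 0 2, cmpOp 1 2]
      (readMem (Parse.ofClause C) (redRep s).1 (redRep s).2.1 (name C) (redRep s).2.2) =
      readMem (Parse.ofClause C) ⟨s.1, d, t⟩ (redRep s).2.1 (name C) (redRep s).2.2 ∧
      (C.length = 3 → d = isBad C ∧ t = isTaut C) := by
    refine ⟨((decide (name C 0 = name C 1) && (sgn C 0 == sgn C 1)) ||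
        (decide (name C 0 = name C 2) && (sgn C 0 == sgn C 2))) ||
        (decide (name C 1 = name C 2) && (sgn C 1 == sgn C 2)),
      ((decide (name C 0 = name C 1) && (sgn C 0 != sgn C 1)) ||
        (decide (name C 0 = name C 2) && (sgn C 0 != sgn C 2))) ||
        (decide (name C 1 = name C 2) && (sgn C 1 != sgn C 2)), ?_, fun h3 => ?_⟩
    · simp [runOps, Op.run, cmpOp, readMem, redRep, Parse.ofClause, hinj]
    · obtain ⟨l₀, l₁, l₂, rfl⟩ := List.length_eq_three.1 h3
      exact ⟨isBad_eq.symm, isTaut_eq.symm⟩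
  rw [h₁, readMem, hregs]
  simp only [runOps_append]
  by_cases h3 : C.length = 3
  · have hw : (Parse.ofClause C).width = 3 := by
      simp [Parse.ofClause, h3]
    obtain ⟨rfl, rfl⟩ := h₂ h3
    have hsgn : (Parse.ofClause C).sign = sgn C := rfl
    simp only [hw, ne_eq, not_true, false_or, hsgn]
    by_cases hb : isBad C = true
    · simp [hb, redStep, runOps, Op.run, readMem, redRep, encodeFormula, encodeClause, blockRegs]
    · by_cases ht : isTaut C = true
      · simp [hb, ht, redStep, runOps, Op.run, readMem, redRep, blockRegs]
      · simp only [hb, ht, redStep, Bool.false_eq_true, if_false, runOps_append, runOps_clausesOps]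
        simp only [runOps, Op.run, List.foldl_cons, List.foldl_nil, readMem, redRep, blockRegs,
          encodeFormula, List.flatMap_append, Mem.mk.injEq, true_and]
        funext k
        rcases k with k | k
        · simp
        · simp [List.replicate_succ]
  · have hw : (Parse.ofClause C).width ≠ 3 := by
      intro h
      have := congrArg Fin.val h
      simp only [Parse.ofClause] at this
      omega
    have hb : isBad C = true := by simp [isBad, h3]
    simp [hw, hb, redStep, runOps, Op.run, readMem, redRep, encodeFormula, encodeClause, blockRegs]

theorem polyTimeComputable_reduction :
    PolyTimeComputable formulaEncoding formulaEncoding reduction := by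
  refine polyTimeComputable_of_phases (Q := Parse × RedState) (R := Fin 3 ⊕ Unit)
    (Parse.init, ⟨false, false, false⟩)
    [.act fun _ => clausesOps (fun _ => false) startT, .pass (readActs redActs []),
      .act fun q => clausesOps (fun _ => false) endT ++ if q.2.seen then [] else [.emit .ket]]
    fun φ => ?_
  have h₀ : (⟨(Parse.init, ⟨false, false, false⟩), [], fun _ => []⟩ :
      Mem (Parse × RedState) Γ' (Fin 3 ⊕ Unit)) =
      ⟨(Parse.init, ⟨false, false, false⟩), [], blockRegs 0 []⟩ := by
    congr 1
    funext k
    rcases k with k | k <;> rfl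
  have h₁ : (⟨(Parse.init, ⟨false, false, false⟩), encodeFormula (instAll 0 [] startT) ++ [],
      blockRegs 0 []⟩ : Mem (Parse × RedState) Γ' (Fin 3 ⊕ Unit)) =
      idle (redRep (false, 0, instAll 0 [] startT)).1 (redRep (false, 0, instAll 0 [] startT)).2.1
        (redRep (false, 0, instAll 0 [] startT)).2.2 := by
    rw [List.append_nil]
    rfl
  have h₂ : idle (redRep (redState φ)).1 (redRep (redState φ)).2.1 (redRep (redState φ)).2.2 =
      ⟨(Parse.init, ⟨(redState φ).1, false, false⟩), encodeFormula (redState φ).2.2,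
        blockRegs (redState φ).2.1 []⟩ := rfl
  have hs : (fun _ => false) = sgn [] := rfl
  simp only [runPhases, List.foldl_cons, List.foldl_nil, Phase.run]
  have e : formulaEncoding.encode φ = encodeFormula φ := rfl
  rw [h₀, hs, runOps_clausesOps, h₁, e,
    foldl_readActs_formula redActs List.nodup_nil redRep redStep runActs_redActs]
  change (runOps (clausesOps (sgn []) endT ++ _) (idle (redRep (redState φ)).1
    (redRep (redState φ)).2.1 (redRep (redState φ)).2.2)).out = encodeFormula (reduction φ)
  rw [← redState, h₂, runOps_append, runOps_clausesOps]
  cases h : (redState φ).1 <;>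
    simp [reduction, h, runOps, Op.run, encodeFormula, encodeClause]

/-! ### Finding the missing clause -/

/-- The kind that follows a given kind, where another block is expected after a block. -/
def nextPos (t : Fin 28) : Fin 28 := if t = 23 then 4 else t + 1

/-- Whether a clause of a given kind begins with a positive literal. -/
def firstSign (t : Fin 28) : Bool := decide (t.val % 2 = 0)

/-- The kind that is expected at the position `p` if the second literal of the clause read has the
sign `b`. This sign tells whether the chain goes on after a block. -/
def expected (p : Fin 28) (b : Bool) : Fin 28 := if p = 4 ∧ b = true then 24 else p

/-- Whether the signs `a` and `b` of the first two literals of the clause read at the position `p`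
show that the expected clause is missing. -/
def isMissing (p : Fin 28) (a b : Bool) : Bool := a != firstSign (expected p b)

/-- The kind of the clause read at the position `p`, where `a` and `b` are the signs of its first
two literals. -/
def actual (p : Fin 28) (a b : Bool) : Fin 28 :=
  if isMissing p a b then expected (nextPos (expected p b)) b else expected p b

/-- The state of the search for the missing clause. -/
structure Search : Type where
  /-- The kind of the missing clause, if it has been found. -/
  missing : Option (Fin 28)
  /-- The expected kind of the next clause. -/
  pos : Fin 28
  /-- The number of the blocks that have been begun before the missing clause was found. -/
  count : ℕ

/-- One step of the search for the missing clause. -/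
def Search.step (s : Search) (D : Clause) : Search where
  missing := if s.missing = none ∧ isMissing s.pos (sgn D 0) (sgn D 1) = true then
    some (expected s.pos (sgn D 1)) else s.missing
  pos := nextPos (actual s.pos (sgn D 0) (sgn D 1))
  count := if s.missing = none ∧ expected s.pos (sgn D 1) = 4 then s.count + 1 else s.count

/-- The result of the search for the missing clause. -/
def search (ψ : Formula) : Search := ψ.foldl Search.step ⟨none, 0, 0⟩

/-- The kind of the missing clause. If no gap has been found, the last clause, of kind 27, is
missing. -/
def Search.kind (s : Search) : Fin 28 := s.missing.getD 27

/-! ### Construction of the assignment -/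

/-- Whether the variable of the `k`-th literal of a clause of kind `t` becomes true, where `b` is
the sign of this literal, `κ` is the kind of the missing clause, and `h` is the phase. -/
def becomesTrue (κ t : Fin 28) (h : Fin 3) (b : Bool) (k : Fin 3) : Bool :=
  match (template t).getD k (.lit 0, true) with
  | (.lit i, p) => decide (h = 1) && ((b == p) == symVal κ h (.lit i))
  | (.aux j d, _) => symVal κ h (.aux j d)

/-- The variables of a clause of kind `t` that become true in phase `h`. -/
def trueVars (κ t : Fin 28) (h : Fin 3) (D : Clause) : List Var :=
  [(0 : Fin 3), 1, 2].flatMap fun k =>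
    if becomesTrue κ t h (sgn D k) k = true then [name D k] else []

/-- The state of the construction of the assignment. -/
structure Build : Type where
  /-- The expected kind of the next clause. -/
  pos : Fin 28
  /-- The number of the blocks that have been begun. -/
  count : ℕ
  /-- Whether the current block is before (0), at (1) or behind (2) that of the missing clause. -/
  phase : Fin 3
  /-- The true variables. -/
  vars : FinAssignment

/-- The next phase, where `ent` tells whether a block begins, and `e` whether it is that of the
missing clause. -/
def nextPhase (ent e : Bool) (h : Fin 3) : Fin 3 :=
  if ent = true then if e = true then 1 else if h = 1 then 2 else h else h

/-- Whether a block begins with the clause read or with the clause that is missing in front of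
it. -/
def begins (p : Fin 28) (a b : Bool) : Bool :=
  decide (expected p b = 4 ∨ actual p a b = 4)

/-- One step of the construction of the assignment, where `κ` is the kind of the missing clause and
`P` is the number of the blocks that begin before it. -/
def Build.step (κ : Fin 28) (P : ℕ) (s : Build) (D : Clause) : Build :=
  let t := actual s.pos (sgn D 0) (sgn D 1)
  let ent := begins s.pos (sgn D 0) (sgn D 1)
  let h := nextPhase ent (decide (P = s.count + ent.toNat)) s.phase
  ⟨nextPos t, s.count + ent.toNat, h, trueVars κ t (effPhase κ t h) D ++ s.vars⟩

/-- The assignment for a gadget formula with a missing clause. It is computed in two passes: the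
first one finds the missing clause, and the second one collects the true variables. -/
def criticalAssignment (ψ : Formula) : FinAssignment :=
  (ψ.foldl (Build.step (search ψ).kind (search ψ).count) ⟨0, 0, 0, []⟩).vars

/-! ### A machine for the assignment -/

/-- The registers of the machine apart from those for the variables of the current clause. -/
inductive SatReg : Type
  /-- A copy of the input. -/
  | input
  /-- The number of the blocks that have been begun when the missing clause is found, in unary. -/
  | found
  /-- The number of the blocks that have been begun in the second pass, in unary. -/
  | current
  deriving DecidableEq

instance : Fintype SatReg := ⟨{.input, .found, .current}, by rintro (_ | _ | _) <;> simp⟩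

/-- The state of the machine. -/
structure SatState : Type where
  /-- The kind of the missing clause, if it has been found. -/
  missing : Option (Fin 28)
  /-- The expected kind of the next clause. -/
  pos : Fin 28
  /-- The current phase. -/
  phase : Fin 3
  /-- The kind of the current clause. -/
  cur : Fin 28
  deriving DecidableEq, Fintype

/-- The actions at the end of a clause in the search for the missing clause. -/
def searchActs : List (Parse × SatState → List (Op (Parse × SatState) Γ' (Fin 3 ⊕ SatReg))) :=
  [fun q =>
    (if q.2.missing = none ∧ expected q.2.pos (q.1.sign 1) = 4 then
      [.push (.inr .found) (.bit true)] else []) ++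
    [.upd fun q => (q.1, { q.2 with
      missing := if q.2.missing = none ∧ isMissing q.2.pos (q.1.sign 0) (q.1.sign 1) = true then
        some (expected q.2.pos (q.1.sign 1)) else q.2.missing
      pos := nextPos (actual q.2.pos (q.1.sign 0) (q.1.sign 1)) })]]

/-- The operations that write the variables of a clause of kind `t` that become true in phase `h`
in front of the output. -/
def trueVarsOps (κ t : Fin 28) (h : Fin 3) (sg : Fin 3 → Bool) :
    List (Op (Parse × SatState) Γ' (Fin 3 ⊕ SatReg)) :=
  [(0 : Fin 3), 1, 2].reverse.flatMap fun k =>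
    if becomesTrue κ t h (sg k) k = true then [.emit .comma, .copy (.inl k)] else []

/-- The actions at the end of a clause in the construction of the assignment. -/
def buildActs : List (Parse × SatState → List (Op (Parse × SatState) Γ' (Fin 3 ⊕ SatReg))) :=
  [fun q =>
    (if begins q.2.pos (q.1.sign 0) (q.1.sign 1) = true then
      [.push (.inr .current) (.bit true)] else []) ++
    [.cmp (.inr .found) (.inr .current) fun e q => (q.1, { q.2 with
      pos := nextPos (actual q.2.pos (q.1.sign 0) (q.1.sign 1))
      phase := nextPhase (begins q.2.pos (q.1.sign 0) (q.1.sign 1)) e q.2.phase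
      cur := actual q.2.pos (q.1.sign 0) (q.1.sign 1) })],
   fun q => trueVarsOps (q.2.missing.getD 27) q.2.cur
    (effPhase (q.2.missing.getD 27) q.2.cur q.2.phase) q.1.sign]

/-- The contents of the registers of the machine. -/
def satRegs (i : List Γ') (n n' : ℕ) : SatReg → List Γ'
  | .input => i
  | .found => List.replicate n (.bit true)
  | .current => List.replicate n' (.bit true)

theorem update_found {v : Fin 3 → List Γ'} {i : List Γ'} {n n' : ℕ} :
    Function.update (Sum.elim v (satRegs i n n')) (.inr .found)
      (.bit true :: satRegs i n n' .found) = Sum.elim v (satRegs i (n + 1) n') := by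
  funext k
  rcases k with k | _ | _ | _ <;> rfl

theorem update_current {v : Fin 3 → List Γ'} {i : List Γ'} {n n' : ℕ} :
    Function.update (Sum.elim v (satRegs i n n')) (.inr .current)
      (.bit true :: satRegs i n n' .current) = Sum.elim v (satRegs i n (n' + 1)) := by
  funext k
  rcases k with k | _ | _ | _ <;> rfl

/-- The representation of the search for the missing clause, and of the clauses that have been
read. -/
def searchRep (s : Search × Formula) : SatState × List Γ' × (SatReg → List Γ') :=
  (⟨s.1.missing, s.1.pos, 0, 0⟩, [], satRegs (encodeFormula s.2).reverse s.1.count 0)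

theorem runActs_searchActs (s : Search × Formula) (D : Clause) :
    runActs searchActs (readMem (Parse.ofClause D) (searchRep s).1 (searchRep s).2.1 (name D)
        (saved [.input] (encodeClause D) (searchRep s).2.2)) =
      readMem (Parse.ofClause D) (searchRep (s.1.step D, s.2 ++ [D])).1
        (searchRep (s.1.step D, s.2 ++ [D])).2.1 (name D)
        (searchRep (s.1.step D, s.2 ++ [D])).2.2 := by
  have hs : saved [.input] (encodeClause D) (searchRep s).2.2 =
      satRegs (encodeFormula (s.2 ++ [D])).reverse s.1.count 0 := by
    funext k
    cases k <;> simp [saved, searchRep, satRegs, encodeFormula]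
  have hsgn : (Parse.ofClause D).sign = sgn D := rfl
  rw [hs]
  simp only [runActs, searchActs, List.foldl_cons, List.foldl_nil, readMem, hsgn, searchRep,
    Search.step]
  split_ifs <;>
    simp only [runOps, Op.run, List.foldl_cons, List.foldl_nil, List.cons_append, List.nil_append,
      hsgn, Sum.elim_inr, update_found, Mem.mk.injEq, Prod.mk.injEq, SatState.mk.injEq, true_and,
      and_true] <;> simp_all

/-- The representation of the construction of the assignment. -/
def buildRep (κ : Option (Fin 28)) (P : ℕ) (s : Build × Fin 28) :
    SatState × List Γ' × (SatReg → List Γ') :=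
  (⟨κ, s.1.pos, s.1.phase, s.2⟩, encodeAssignment s.1.vars, satRegs [] P s.1.count)

theorem runOps_trueVarsOps (κ t : Fin 28) (h : Fin 3) (D : Clause) (q : Parse × SatState)
    (T : FinAssignment) (r : SatReg → List Γ') :
    runOps (trueVarsOps κ t h (sgn D))
        ⟨q, encodeAssignment T, Sum.elim (fun k => ((name D k).map Γ'.bit).reverse) r⟩ =
      ⟨q, encodeAssignment (trueVars κ t h D ++ T),
        Sum.elim (fun k => ((name D k).map Γ'.bit).reverse) r⟩ := by
  rw [trueVarsOps, runOps_flatMap_reverse (w := fun k => encodeAssignment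
    (if becomesTrue κ t h (sgn D k) k = true then [name D k] else []))]
  · simp [encodeAssignment, trueVars]
  · intro k q o
    split_ifs <;> simp [runOps, Op.run, encodeAssignment]

theorem runActs_buildActs (κ : Option (Fin 28)) (P : ℕ) (s : Build × Fin 28) (D : Clause) :
    runActs buildActs (readMem (Parse.ofClause D) (buildRep κ P s).1 (buildRep κ P s).2.1 (name D)
        (saved [] (encodeClause D) (buildRep κ P s).2.2)) =
      readMem (Parse.ofClause D)
        (buildRep κ P (s.1.step (κ.getD 27) P D, actual s.1.pos (sgn D 0) (sgn D 1))).1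
        (buildRep κ P (s.1.step (κ.getD 27) P D, actual s.1.pos (sgn D 0) (sgn D 1))).2.1 (name D)
        (buildRep κ P (s.1.step (κ.getD 27) P D, actual s.1.pos (sgn D 0) (sgn D 1))).2.2 := by
  have hsgn : (Parse.ofClause D).sign = sgn D := rfl
  have hcmp : ∀ n, (satRegs [] P n .found = satRegs [] P n .current) ↔ P = n := by
    intro n
    exact (List.replicate_left_injective (Γ'.bit true)).eq_iff
  rw [saved_nil_left]
  simp only [runActs, buildActs, List.foldl_cons, List.foldl_nil, readMem, buildRep, hsgn,
    runOps_append, Build.step]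
  have h₁ : runOps (if begins s.1.pos (sgn D 0) (sgn D 1) = true then
      [Op.push (.inr .current) (.bit true)] else [])
      (⟨(Parse.ofClause D, ⟨κ, s.1.pos, s.1.phase, s.2⟩), encodeAssignment s.1.vars,
        Sum.elim (fun k => ((name D k).map Γ'.bit).reverse) (satRegs [] P s.1.count)⟩ :
        Mem (Parse × SatState) Γ' (Fin 3 ⊕ SatReg)) =
      ⟨(Parse.ofClause D, ⟨κ, s.1.pos, s.1.phase, s.2⟩), encodeAssignment s.1.vars,
        Sum.elim (fun k => ((name D k).map Γ'.bit).reverse)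
          (satRegs [] P (s.1.count + (begins s.1.pos (sgn D 0) (sgn D 1)).toNat))⟩ := by
    cases begins s.1.pos (sgn D 0) (sgn D 1)
    · rfl
    · simp only [if_true, runOps_cons, runOps_nil, Op.run, Sum.elim_inr, update_current]
      rfl
  rw [h₁]
  simp only [runOps_cons, runOps_nil, Op.run, Sum.elim_inr, hcmp, hsgn]
  rw [runOps_trueVarsOps]

theorem polyTimeComputable_criticalAssignment :
    PolyTimeComputable formulaEncoding assignmentEncoding criticalAssignment := by
  refine polyTimeComputable_of_phases (Q := Parse × SatState) (R := Fin 3 ⊕ SatReg)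
    (Parse.init, ⟨none, 0, 0, 0⟩)
    [.pass (readActs searchActs [.input]), .pour (.inr .input),
      .act fun _ => [.upd fun q => (q.1, { q.2 with pos := 0 })],
      .pass (readActs buildActs [])]
    fun ψ => ?_
  have h₀ : (⟨(Parse.init, ⟨none, 0, 0, 0⟩), [], fun _ => []⟩ :
      Mem (Parse × SatState) Γ' (Fin 3 ⊕ SatReg)) =
      idle (searchRep (⟨none, 0, 0⟩, [])).1 (searchRep (⟨none, 0, 0⟩, [])).2.1
        (searchRep (⟨none, 0, 0⟩, [])).2.2 := by
    simp only [idle, readMem, searchRep, Mem.mk.injEq, true_and]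
    funext k
    rcases k with k | _ | _ | _ <;> rfl
  have e : formulaEncoding.encode ψ = encodeFormula ψ := rfl
  have hfold : ∀ (χ : Formula) (s : Search × Formula),
      χ.foldl (fun s D => (s.1.step D, s.2 ++ [D])) s = (χ.foldl Search.step s.1, s.2 ++ χ) := by
    intro χ
    induction χ with
    | nil => intro s; simp
    | cons D χ ih => intro s; rw [List.foldl_cons, ih]; simp
  have hfold' : ∀ (κ : Fin 28) (P : ℕ) (χ : Formula) (s : Build × Fin 28),
      (χ.foldl (fun s D => (s.1.step κ P D, actual s.1.pos (sgn D 0) (sgn D 1))) s).1 =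
        χ.foldl (Build.step κ P) s.1 := by
    intro κ P χ
    induction χ with
    | nil => intro s; rfl
    | cons D χ ih => intro s; rw [List.foldl_cons, ih]; rfl
  simp only [runPhases, List.foldl_cons, List.foldl_nil, Phase.run]
  rw [h₀, e, foldl_readActs_formula searchActs (List.nodup_singleton _) searchRep
    (fun s D => (s.1.step D, s.2 ++ [D])) runActs_searchActs, hfold]
  have h₁ : (⟨(Parse.init, ⟨(search ψ).missing, 0, 0, 0⟩), [],
      Function.update (Sum.elim (fun _ => []) (satRegs (encodeFormula ψ).reverse
        (search ψ).count 0)) (.inr .input) []⟩ : Mem (Parse × SatState) Γ' (Fin 3 ⊕ SatReg)) =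
      idle (buildRep (search ψ).missing (search ψ).count (⟨0, 0, 0, []⟩, 0)).1
        (buildRep (search ψ).missing (search ψ).count (⟨0, 0, 0, []⟩, 0)).2.1
        (buildRep (search ψ).missing (search ψ).count (⟨0, 0, 0, []⟩, 0)).2.2 := by
    simp only [idle, readMem, buildRep, encodeAssignment, List.flatMap_nil, Mem.mk.injEq, true_and]
    funext k
    rcases k with k | _ | _ | _ <;> rfl
  change (List.foldl _ (⟨(Parse.init, ⟨(search ψ).missing, 0, 0, 0⟩), [],
      Function.update (Sum.elim (fun _ => []) (satRegs (encodeFormula ψ).reverse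
        (search ψ).count 0)) (.inr .input) []⟩ : Mem (Parse × SatState) Γ' (Fin 3 ⊕ SatReg))
      ((encodeFormula ψ).reverse.reverse ++ [])).out = _
  rw [h₁, List.reverse_reverse, List.append_nil, foldl_readActs_formula buildActs List.nodup_nil
    (buildRep (search ψ).missing (search ψ).count)
    (fun s D => (s.1.step ((search ψ).missing.getD 27) (search ψ).count D,
      actual s.1.pos (sgn D 0) (sgn D 1))) (runActs_buildActs _ _)]
  simp only [idle, readMem, buildRep, hfold']
  rfl

/-! ### The clauses of the gadget formula with their kinds -/

/-- A clause of a gadget formula, given by its kind and by the index and the clause of its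
block. -/
structure Entry : Type where
  /-- The kind of the clause. -/
  kind : Fin 28
  /-- The index of the block. -/
  idx : ℕ
  /-- The clause of the block. -/
  cls : Clause

/-- The clause that an entry stands for. -/
def Entry.clause (y : Entry) : Clause := (template y.kind).map (instLit y.idx y.cls)

/-- The kinds of the clauses of a block. -/
def blockKinds : List (Fin 28) :=
  [4, 5, 6, 7, 8, 9, 10, 11, 12, 13, 14, 15, 16, 17, 18, 19, 20, 21, 22, 23]

/-- The entries of the blocks for a list of clauses. -/
def blockEntries : List Clause → List Entry
  | [] => []
  | C :: G => blockKinds.map (fun t => ⟨t, G.length, C⟩) ++ blockEntries G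

/-- The entries of the gadget formula for a list of clauses. -/
def entries (G : List Clause) : List Entry :=
  [0, 1, 2, 3].map (fun t => ⟨t, G.length, []⟩) ++
    (blockEntries G ++ [24, 25, 26, 27].map (fun t => ⟨t, 0, []⟩))

theorem map_clause (ts : List (Fin 28)) (n : ℕ) (C : Clause) :
    (ts.map (fun t => (⟨t, n, C⟩ : Entry))).map Entry.clause =
      instAll n C (ts.map template) := by
  simp [instAll, Entry.clause]

theorem map_clause_entries (G : List Clause) : (entries G).map Entry.clause = gadget G := by
  have hb : (blockEntries G).map Entry.clause = blocks G := by
    induction G with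
    | nil => rfl
    | cons C G ih =>
      rw [blockEntries, List.map_append, map_clause, ih]
      rfl
  rw [entries, List.map_append, List.map_append, map_clause, map_clause, hb]
  rfl

/-- The properties of the entries of the gadget formula for `G`. -/
structure Entry.Valid (G : List Clause) (y : Entry) : Prop where
  end_idx : y.kind.val < 4 → y.idx = G.length
  block : inBlock y.kind = true → ∃ G₁ G₂, G = G₁ ++ y.cls :: G₂ ∧ y.idx = G₂.length
  start_idx : 24 ≤ y.kind.val → y.idx = 0

theorem mem_blockEntries {G : List Clause} {y : Entry} (h : y ∈ blockEntries G) :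
    inBlock y.kind = true ∧ ∃ G₁ G₂, G = G₁ ++ y.cls :: G₂ ∧ y.idx = G₂.length := by
  induction G with
  | nil => simp [blockEntries] at h
  | cons C G ih =>
    rw [blockEntries, List.mem_append] at h
    rcases h with h | h
    · obtain ⟨t, ht, rfl⟩ := List.mem_map.1 h
      have : ∀ t ∈ blockKinds, inBlock t = true := by decide
      exact ⟨this t ht, [], G, rfl, rfl⟩
    · obtain ⟨hb, G₁, G₂, rfl, hi⟩ := ih h
      exact ⟨hb, C :: G₁, G₂, rfl, hi⟩

theorem valid_of_mem_entries {G : List Clause} {y : Entry} (h : y ∈ entries G) : y.Valid G := by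
  rw [entries, List.mem_append, List.mem_append] at h
  rcases h with h | h | h
  · simp only [List.map_cons, List.map_nil, List.mem_cons, List.not_mem_nil, or_false] at h
    rcases h with rfl | rfl | rfl | rfl <;> constructor <;> simp [inBlock]
  · obtain ⟨hb, h⟩ := mem_blockEntries h
    simp only [inBlock, Bool.and_eq_true, decide_eq_true_eq] at hb
    exact ⟨fun _ => by omega, fun _ => h, fun _ => by omega⟩
  · simp only [List.map_cons, List.map_nil, List.mem_cons, List.not_mem_nil, or_false] at h
    rcases h with rfl | rfl | rfl | rfl <;> constructor <;> simp [inBlock]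

theorem nodup_entries (G : List Clause) :
    ((entries G).map fun y => (y.kind, y.idx)).Nodup := by
  have hmap : ∀ (ts : List (Fin 28)) (n : ℕ) (C : Clause), ts.Nodup →
      ((ts.map (fun t => (⟨t, n, C⟩ : Entry))).map fun y => (y.kind, y.idx)).Nodup := by
    intro ts n C h
    rw [List.map_map]
    exact h.map fun t t' h => (Prod.mk.inj h).1
  have hb : ((blockEntries G).map fun y => (y.kind, y.idx)).Nodup := by
    induction G with
    | nil => simp [blockEntries]
    | cons C G ih =>
      rw [blockEntries, List.map_append]
      refine (hmap _ _ _ (by decide)).append ih fun k hk hk' => ?_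
      obtain ⟨y, hy, rfl⟩ := List.mem_map.1 hk
      obtain ⟨y', hy', h⟩ := List.mem_map.1 hk'
      obtain ⟨t, -, rfl⟩ := List.mem_map.1 hy
      obtain ⟨-, G₁, G₂, h₁, h₂⟩ := mem_blockEntries hy'
      have h₃ : y'.idx = G.length := (Prod.mk.inj h).2
      have := congrArg List.length h₁
      rw [List.length_append, List.length_cons] at this
      omega
  rw [entries, List.map_append, List.map_append]
  refine (hmap _ _ _ (by decide)).append (hb.append (hmap _ _ _ (by decide)) ?_) ?_
  · intro k hk hk'
    obtain ⟨y, hy, rfl⟩ := List.mem_map.1 hk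
    obtain ⟨y', hy', h⟩ := List.mem_map.1 hk'
    obtain ⟨t, ht, rfl⟩ := List.mem_map.1 hy'
    have hy := (mem_blockEntries hy).1
    rw [← (Prod.mk.inj h).1] at hy
    have : ∀ t ∈ ([24, 25, 26, 27] : List (Fin 28)), inBlock t = false := by decide
    exact Bool.false_ne_true ((this t ht).symm.trans hy)
  · intro k hk hk'
    obtain ⟨y', hy', h⟩ := List.mem_map.1 hk
    obtain ⟨t, ht, rfl⟩ := List.mem_map.1 hy'
    have ht : t.val < 4 := (by decide : ∀ t ∈ ([0, 1, 2, 3] : List (Fin 28)), t.val < 4) t ht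
    rw [← List.map_append] at hk'
    obtain ⟨y, hy, rfl⟩ := List.mem_map.1 hk'
    have h : t = y.kind := (Prod.mk.inj h).1
    rcases List.mem_append.1 hy with hy | hy
    · have hy := (mem_blockEntries hy).1
      simp only [inBlock, Bool.and_eq_true, decide_eq_true_eq, ← h] at hy
      omega
    · obtain ⟨t', ht', rfl⟩ := List.mem_map.1 hy
      have ht' : 24 ≤ t'.val :=
        (by decide : ∀ t ∈ ([24, 25, 26, 27] : List (Fin 28)), 24 ≤ t.val) t' ht'
      simp only at h
      omega

/-- Whether a clause of kind `t` can follow where the kind `p` is expected. -/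
def Follows (p t : Fin 28) : Prop := t = p ∨ p = 4 ∧ t = 24

instance (p t : Fin 28) : Decidable (Follows p t) := inferInstanceAs (Decidable (_ ∨ _))

/-- A list of entries is part of a gadget formula with `m` blocks, where the kind `p` is expected at
its beginning and `n` blocks have begun before. -/
def Path (m : ℕ) : Fin 28 → ℕ → List Entry → Prop
  | _, _, [] => True
  | p, n, y :: L => Follows p y.kind ∧
      (inBlock y.kind = true → 1 ≤ n + (decide (y.kind = 4)).toNat ∧
        y.idx + (n + (decide (y.kind = 4)).toNat) = m) ∧
      Path m (nextPos y.kind) (n + (decide (y.kind = 4)).toNat) L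

theorem path_entries (G : List Clause) : Path G.length 0 0 (entries G) := by
  have hb : ∀ (G : List Clause) (m n : ℕ), n + G.length = m →
      Path m 4 n (blockEntries G ++ [24, 25, 26, 27].map (fun t => ⟨t, 0, []⟩)) := by
    intro G
    induction G with
    | nil =>
      intro m n _
      simp [blockEntries, Path, Follows, nextPos, inBlock]
    | cons C G ih =>
      intro m n h
      rw [List.length_cons] at h
      have := ih m (n + 1) (by omega)
      simp [blockEntries, blockKinds, Path, Follows, nextPos, inBlock]
      exact ⟨by omega, this⟩
  have := hb G G.length 0 (by omega)
  simpa [entries, Path, Follows, nextPos, inBlock] using this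

/-- The last clause of the gadget formula has the kind 27. -/
theorem kind_of_entries_eq {G : List Clause} {L : List Entry} {x : Entry}
    (h : entries G = L ++ [x]) : x.kind = 27 := by
  have h' : entries G = ([0, 1, 2, 3].map (fun t => ⟨t, G.length, []⟩) ++
      (blockEntries G ++ [24, 25, 26].map (fun t => ⟨t, 0, []⟩))) ++ [⟨27, 0, []⟩] := by
    simp [entries]
  have := List.append_inj_right' (h.symm.trans h') rfl
  rw [List.singleton_inj.1 this]

/-! ### The missing clause is found -/

/-- The sign of the second literal of a clause of kind `t` where it matters for the search. -/
def SecondSign (t : Fin 28) (b : Bool) : Prop :=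
  (t = 4 ∨ t = 5 → b = false) ∧ (t = 24 ∨ t = 25 → b = true)

instance (t : Fin 28) (b : Bool) : Decidable (SecondSign t b) :=
  inferInstanceAs (Decidable (_ ∧ _))

theorem length_template : ∀ t, (template t).length = 3 := by decide

/-- The sign of a symbolic literal, if its variable does not depend on a clause. -/
def SLit.auxSign : SLit → Option Bool
  | (.lit _, _) => none
  | (.aux _ _, p) => some p

theorem sgn_clause {y : Entry} {k : Fin 3} {b : Bool}
    (h : (template y.kind)[(k : ℕ)]?.bind SLit.auxSign = some b) : sgn y.clause k = b := by
  obtain ⟨⟨v, p⟩, hl, hb⟩ := Option.bind_eq_some_iff.1 h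
  cases v with
  | lit i => simp [SLit.auxSign] at hb
  | aux j d =>
    simp only [SLit.auxSign, Option.some.injEq] at hb
    simp [sgn, Entry.clause, hl, instLit, hb]

theorem sgn_clause_zero (y : Entry) : sgn y.clause 0 = firstSign y.kind :=
  sgn_clause <| (by decide : ∀ t, (template t)[((0 : Fin 3) : ℕ)]?.bind SLit.auxSign =
    some (firstSign t)) y.kind

theorem secondSign_clause (y : Entry) : SecondSign y.kind (sgn y.clause 1) :=
  ⟨fun h => sgn_clause <| (by decide : ∀ t, t = 4 ∨ t = 5 →
      (template t)[((1 : Fin 3) : ℕ)]?.bind SLit.auxSign = some false) y.kind h,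
    fun h => sgn_clause <| (by decide : ∀ t, t = 24 ∨ t = 25 →
      (template t)[((1 : Fin 3) : ℕ)]?.bind SLit.auxSign = some true) y.kind h⟩

/-- A clause is recognized if no clause is missing in front of it. -/
theorem read_present : ∀ p t : Fin 28, Follows p t → ∀ b, SecondSign t b →
    isMissing p (firstSign t) b = false ∧ expected p b = t ∧ actual p (firstSign t) b = t ∧
      begins p (firstSign t) b = decide (t = 4) := by
  decide +kernel

/-- A missing clause of kind `x` is noticed at the next clause, of kind `t`, as the first signs of
the clauses alternate. -/
theorem read_missing : ∀ p x : Fin 28, Follows p x → ∀ t, Follows (nextPos x) t →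
    ∀ b, SecondSign t b →
    isMissing p (firstSign t) b = true ∧ expected p b = x ∧ actual p (firstSign t) b = t ∧
      (begins p (firstSign t) b).toNat = (decide (x = 4)).toNat + (decide (t = 4)).toNat := by
  decide +kernel

theorem foldl_step_of_missing (ψ : Formula) (s : Search) (h : s.missing ≠ none) :
    (ψ.foldl Search.step s).missing = s.missing ∧ (ψ.foldl Search.step s).count = s.count := by
  induction ψ generalizing s with
  | nil => exact ⟨rfl, rfl⟩
  | cons D ψ ih =>
    have h₁ : (s.step D).missing = s.missing := by simp [Search.step, h]
    have h₂ : (s.step D).count = s.count := by simp [Search.step, h]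
    rw [List.foldl_cons, ← h₁, ← h₂]
    exact ih _ (by rwa [h₁])

/-- The search finds the kind of the missing clause `x`, and the number of the block to which it
belongs, counted from the end of the chain. -/
theorem search_spec {m : ℕ} {x : Entry} {L₂ : List Entry} (hx : L₂ = [] → x.kind = 27)
    (L₁ : List Entry) (p : Fin 28) (n : ℕ) (h : Path m p n (L₁ ++ x :: L₂)) :
    (((L₁ ++ L₂).map Entry.clause).foldl Search.step ⟨none, p, n⟩).kind = x.kind ∧
    (inBlock x.kind = true →
      1 ≤ (((L₁ ++ L₂).map Entry.clause).foldl Search.step ⟨none, p, n⟩).count ∧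
      x.idx + (((L₁ ++ L₂).map Entry.clause).foldl Search.step ⟨none, p, n⟩).count = m) := by
  induction L₁ generalizing p n with
  | nil =>
    obtain ⟨h₁, h₂, h₃⟩ := h
    cases L₂ with
    | nil => simp [Search.kind, hx, inBlock]
    | cons y L =>
      obtain ⟨e₁, e₂, e₃, -⟩ := read_missing p x.kind h₁ y.kind h₃.1 _ (secondSign_clause y)
      have hs : Search.step ⟨none, p, n⟩ y.clause = ⟨some x.kind, nextPos y.kind,
          n + (decide (x.kind = 4)).toNat⟩ := by
        simp only [Search.step, sgn_clause_zero, e₁, e₂, e₃, true_and, if_true]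
        by_cases h4 : x.kind = 4 <;> simp [h4]
      simp only [List.nil_append, List.map_cons, List.foldl_cons, hs]
      obtain ⟨e, e'⟩ := foldl_step_of_missing (L.map Entry.clause)
        ⟨some x.kind, nextPos y.kind, n + (decide (x.kind = 4)).toNat⟩ (by simp)
      rw [Search.kind, e, e']
      exact ⟨rfl, h₂⟩
  | cons y L₁ ih =>
    obtain ⟨h₁, -, h₃⟩ := h
    obtain ⟨e₁, e₂, e₃, -⟩ := read_present p y.kind h₁ _ (secondSign_clause y)
    have hs : Search.step ⟨none, p, n⟩ y.clause = ⟨none, nextPos y.kind,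
        n + (decide (y.kind = 4)).toNat⟩ := by
      simp only [Search.step, sgn_clause_zero, e₁, e₂, e₃, true_and, Bool.false_eq_true, and_false,
        if_false]
      by_cases h4 : y.kind = 4 <;> simp [h4]
    simp only [List.cons_append, List.map_cons, List.foldl_cons, hs]
    exact ih _ _ h₃

/-! ### The assignment that is constructed -/

/-- The phase of a block with index `n` if the missing clause belongs to that with index `n'`. -/
def phaseAt (n' n : ℕ) : Fin 3 := if n' < n then 0 else if n = n' then 1 else 2

/-- The phase that is used for the entry `y` if `x` is the entry of the missing clause. -/
def Entry.phase (x y : Entry) : Fin 3 := effPhase x.kind y.kind (phaseAt x.idx y.idx)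

theorem nextPhase_spec {P n : ℕ} {h : Fin 3} (hh : h = phaseAt n P) (b : Bool) :
    nextPhase b (decide (P = n + b.toNat)) h = phaseAt (n + b.toNat) P := by
  subst hh
  cases b
  · simp [nextPhase]
  · simp only [nextPhase, phaseAt, Bool.toNat_true, decide_eq_true_eq, if_true]
    split_ifs <;> first | rfl | omega

/-- The phase that is determined by counting is that given by the indices. -/
theorem effPhase_eq {m P n : ℕ} {h : Fin 3} {x y : Entry}
    (hP : inBlock x.kind = true → 1 ≤ P ∧ x.idx + P = m)
    (hh : 1 ≤ P → h = phaseAt n P) (hy : inBlock y.kind = true → 1 ≤ n ∧ y.idx + n = m) :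
    effPhase x.kind y.kind h = x.phase y := by
  unfold Entry.phase effPhase
  split_ifs with h₁ h₂ h₃
  · rfl
  · rfl
  · obtain ⟨hP₁, hP₂⟩ := hP h₃
    obtain ⟨-, hn⟩ := hy (by simp [inBlock]; omega)
    rw [hh hP₁, phaseAt, phaseAt]
    split_ifs <;> first | rfl | omega
  · rfl

/-- The variables that are added to the assignment, starting from `T`. -/
def addVars (x : Entry) (T : FinAssignment) (L : List Entry) : FinAssignment :=
  L.foldl (fun T y => trueVars x.kind y.kind (x.phase y) y.clause ++ T) T

theorem mem_addVars {x : Entry} {T : FinAssignment} {L : List Entry} {v : Var} :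
    v ∈ addVars x T L ↔
      (∃ y ∈ L, v ∈ trueVars x.kind y.kind (x.phase y) y.clause) ∨ v ∈ T := by
  induction L generalizing T with
  | nil => simp [addVars]
  | cons y L ih =>
    change v ∈ addVars x _ L ↔ _
    rw [ih, List.mem_append, List.exists_mem_cons_iff, ← or_assoc]
    exact or_congr_left or_comm

section Construction

variable {m P : ℕ} {x : Entry} (hP : inBlock x.kind = true → 1 ≤ P ∧ x.idx + P = m)

include hP

/-- The part of the construction behind the missing clause. -/
theorem build_present (L : List Entry) (s : Build) (h : Path m s.pos s.count L)
    (hh : 1 ≤ P → s.phase = phaseAt s.count P) :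
    ((L.map Entry.clause).foldl (Build.step x.kind P) s).vars = addVars x s.vars L := by
  induction L generalizing s with
  | nil => rfl
  | cons y L ih =>
    obtain ⟨h₁, h₂, h₃⟩ := h
    obtain ⟨-, -, e₃, e₄⟩ := read_present s.pos y.kind h₁ _ (secondSign_clause y)
    have hh' : 1 ≤ P → nextPhase (decide (y.kind = 4))
        (decide (P = s.count + (decide (y.kind = 4)).toNat)) s.phase =
        phaseAt (s.count + (decide (y.kind = 4)).toNat) P := fun hP₁ =>
      nextPhase_spec (hh hP₁) _
    have hs : s.step x.kind P y.clause = ⟨nextPos y.kind, s.count + (decide (y.kind = 4)).toNat,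
        nextPhase (decide (y.kind = 4))
          (decide (P = s.count + (decide (y.kind = 4)).toNat)) s.phase,
        trueVars x.kind y.kind (x.phase y) y.clause ++ s.vars⟩ := by
      simp only [Build.step, sgn_clause_zero, e₃, e₄]
      rw [effPhase_eq hP hh' h₂]
    simp only [List.map_cons, List.foldl_cons, hs]
    exact ih _ h₃ hh'

theorem build_missing {L₂ : List Entry} (L₁ : List Entry) (s : Build)
    (h : Path m s.pos s.count (L₁ ++ x :: L₂)) (hh : 1 ≤ P → s.phase = phaseAt s.count P) :
    (((L₁ ++ L₂).map Entry.clause).foldl (Build.step x.kind P) s).vars =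
      addVars x s.vars (L₁ ++ L₂) := by
  induction L₁ generalizing s with
  | nil =>
    obtain ⟨h₁, h₂, h₃⟩ := h
    cases L₂ with
    | nil => rfl
    | cons y L =>
      obtain ⟨h₃, h₄, h₅⟩ := h₃
      obtain ⟨-, -, e₃, e₄⟩ := read_missing s.pos x.kind h₁ y.kind h₃ _ (secondSign_clause y)
      rw [add_assoc, ← e₄] at h₄ h₅
      have hh' : 1 ≤ P → nextPhase (begins s.pos (firstSign y.kind) (sgn y.clause 1))
          (decide (P = s.count + (begins s.pos (firstSign y.kind) (sgn y.clause 1)).toNat))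
          s.phase =
          phaseAt (s.count + (begins s.pos (firstSign y.kind) (sgn y.clause 1)).toNat) P :=
        fun hP₁ => nextPhase_spec (hh hP₁) _
      have hs : s.step x.kind P y.clause = ⟨nextPos y.kind,
          s.count + (begins s.pos (firstSign y.kind) (sgn y.clause 1)).toNat,
          nextPhase (begins s.pos (firstSign y.kind) (sgn y.clause 1))
            (decide (P = s.count + (begins s.pos (firstSign y.kind) (sgn y.clause 1)).toNat))
            s.phase,
          trueVars x.kind y.kind (x.phase y) y.clause ++ s.vars⟩ := by
        simp only [Build.step, sgn_clause_zero, e₃]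
        rw [effPhase_eq hP hh' h₄]
      simp only [List.nil_append, List.map_cons, List.foldl_cons, hs]
      exact build_present hP _ _ h₅ hh'
  | cons y L₁ ih =>
    obtain ⟨h₁, h₂, h₃⟩ := h
    obtain ⟨-, -, e₃, e₄⟩ := read_present s.pos y.kind h₁ _ (secondSign_clause y)
    have hh' : 1 ≤ P → nextPhase (decide (y.kind = 4))
        (decide (P = s.count + (decide (y.kind = 4)).toNat)) s.phase =
        phaseAt (s.count + (decide (y.kind = 4)).toNat) P := fun hP₁ =>
      nextPhase_spec (hh hP₁) _
    have hs : s.step x.kind P y.clause = ⟨nextPos y.kind, s.count + (decide (y.kind = 4)).toNat,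
        nextPhase (decide (y.kind = 4))
          (decide (P = s.count + (decide (y.kind = 4)).toNat)) s.phase,
        trueVars x.kind y.kind (x.phase y) y.clause ++ s.vars⟩ := by
      simp only [Build.step, sgn_clause_zero, e₃, e₄]
      rw [effPhase_eq hP hh' h₂]
    simp only [List.cons_append, List.map_cons, List.foldl_cons, hs]
    exact ih _ h₃ hh'

end Construction

theorem criticalAssignment_eq {G : List Clause} {L₁ L₂ : List Entry} {x : Entry}
    (h : entries G = L₁ ++ x :: L₂) :
    criticalAssignment ((L₁ ++ L₂).map Entry.clause) = addVars x [] (L₁ ++ L₂) := by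
  have hp := path_entries G
  rw [h] at hp
  obtain ⟨hκ, hP⟩ := search_spec (by rintro rfl; exact kind_of_entries_eq h) L₁ 0 0 hp
  rw [criticalAssignment, search, hκ]
  exact build_missing hP L₁ ⟨0, 0, 0, []⟩ hp fun hP₁ => (if_pos hP₁).symm

/-! ### The assignment satisfies the remaining clauses -/

/-- Whether the variable denoted by a symbolic variable becomes true because of an entry with the
clause `C` in phase `h`. -/
def svarValue (κ : Fin 28) (h : Fin 3) (C : Clause) : SVar → Bool
  | .lit i => decide (h = 1) && (sgn C i == symVal κ h (.lit i))
  | .aux j d => symVal κ h (.aux j d)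

theorem mem_trueVars {κ : Fin 28} {h : Fin 3} {y : Entry} {v : Var} :
    v ∈ trueVars κ y.kind h y.clause ↔
      ∃ l ∈ template y.kind, v = (instLit y.idx y.cls l).1 ∧ svarValue κ h y.cls l.1 = true := by
  obtain ⟨l₀, l₁, l₂, hl⟩ := List.length_eq_three.1 (length_template y.kind)
  have hb : ∀ k l, (template y.kind)[(k : Fin 3).val]? = some l →
      becomesTrue κ y.kind h (sgn y.clause k) k = svarValue κ h y.cls l.1 ∧
      name y.clause k = (instLit y.idx y.cls l).1 := by
    rintro k ⟨v, p⟩ hk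
    have hn : name y.clause k = (instLit y.idx y.cls (v, p)).1 := by
      simp [name, Entry.clause, hk]
    have hs : sgn y.clause k = (instLit y.idx y.cls (v, p)).2 := by
      simp [sgn, Entry.clause, hk]
    refine ⟨?_, hn⟩
    rw [becomesTrue, List.getD_eq_getElem?_getD, hk, hs]
    cases v with
    | lit i =>
      simp only [Option.getD_some, svarValue, instLit]
      cases sgn y.cls i <;> cases p <;> rfl
    | aux j d => rfl
  have h₀ := hb 0 l₀ (by rw [hl]; rfl)
  have h₁ := hb 1 l₁ (by rw [hl]; rfl)
  have h₂ := hb 2 l₂ (by rw [hl]; rfl)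
  have hmem : ∀ (b : Bool) (w : Var), v ∈ (if b = true then [w] else []) ↔ v = w ∧ b = true := by
    intro b w
    cases b <;> simp
  simp only [trueVars, List.flatMap_cons, List.flatMap_nil, List.append_nil, List.mem_append, hmem,
    h₀, h₁, h₂, hl, List.mem_cons, List.not_mem_nil, or_false, exists_eq_or_imp, exists_eq_left]

/-- The auxiliary variables of the clauses of each kind: the chain variables, the selector and the
escape variable of a block, and the splitting variable of the pair. -/
theorem aux_cases : ∀ t, ∀ l ∈ template t, ∀ j d p, l = (.aux j d, p) →
    (j < 3 ∧ (d = true → inBlock t = true)) ∨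
    ((j = 3 ∨ j = 4) ∧ d = false ∧ inBlock t = true) ∨ (j = pairOf t + 5 ∧ d = false) := by
  have h : ∀ t, (template t).all (fun l => match l.1 with
      | .lit _ => true
      | .aux j d => decide ((j < 3 ∧ (d = true → inBlock t = true)) ∨
          ((j = 3 ∨ j = 4) ∧ d = false ∧ inBlock t = true) ∨ (j = pairOf t + 5 ∧ d = false))) =
        true := by
    decide +kernel
  rintro t l hl j d p rfl
  exact of_decide_eq_true (List.all_eq_true.1 (h t) _ hl)

theorem highVal_eq_lowVal : ∀ κ, inBlock κ = false → ∀ j < 3, highVal κ j = lowVal κ j := by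
  decide +kernel

theorem effPhase_congr : ∀ t t', pairOf t = pairOf t' → ∀ κ h,
    effPhase κ t h = effPhase κ t' h := by
  decide +kernel

/-- The value of a chain variable only depends on its index. -/
theorem symVal_chain {G : List Clause} {x y : Entry} (hx : x.Valid G) (hy : y.Valid G) {j : ℕ}
    {d : Bool} (hj : j < 3) (hd : d = true → inBlock y.kind = true) :
    symVal x.kind (x.phase y) (.aux j d) =
      if x.idx < y.idx + d.toNat then highVal x.kind j else lowVal x.kind j := by
  have hj' : j < 5 := by omega
  simp only [symVal, baseVal, hj, hj', if_true]
  by_cases hb : inBlock x.kind = true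
  · obtain ⟨G₁, G₂, hG, hi⟩ := hx.block hb
    have hlen : x.idx < G.length := by
      rw [hG, hi, List.length_append, List.length_cons]; omega
    have hd' : ¬ inBlock y.kind = true → d.toNat = 0 := by
      intro h
      cases d
      · rfl
      · exact absurd (hd rfl) h
    refine if_congr ?_ rfl rfl
    have hend := hy.end_idx
    have hstart := hy.start_idx
    simp only [inBlock, Bool.and_eq_true, decide_eq_true_eq] at hd'
    unfold Entry.phase effPhase phaseAt
    cases d <;> simp only [Bool.toNat_true, Bool.toNat_false] at hd' ⊢ <;> split_ifs <;>
      first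
        | (exfalso; omega)
        | exact iff_of_true (by simp) (by omega)
        | exact iff_of_false (by simp) (by omega)
  · rw [highVal_eq_lowVal _ (by simpa using hb) j hj]
    simp

theorem Entry.phase_eq_one {x y : Entry} (h : x.phase y = 1) :
    inBlock x.kind = true ∧ inBlock y.kind = true ∧ y.idx = x.idx := by
  unfold Entry.phase effPhase phaseAt at h
  split_ifs at h with h₁ h₂ h₃ h₄ h₅ <;> first | exact absurd h (by decide) | skip
  exact ⟨h₃, by simp [inBlock]; omega, h₅⟩

theorem cls_eq {G : List Clause} {y y' : Entry} (hy : y.Valid G) (hy' : y'.Valid G)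
    (hb : inBlock y.kind = true) (hb' : inBlock y'.kind = true) (h : y.idx = y'.idx) :
    y.cls = y'.cls := by
  obtain ⟨G₁, G₂, hG, hi⟩ := hy.block hb
  obtain ⟨G₁', G₂', hG', hi'⟩ := hy'.block hb'
  exact (List.cons_eq_cons.1 (List.append_inj' (hG.symm.trans hG')
    (by simp only [List.length_cons]; omega)).2).1

theorem name_injective {C : Clause} (h3 : C.length = 3) (hC : C.Nodup)
    (ht : ∀ l ∈ C, (l.1, !l.2) ∉ C) : Function.Injective (name C) := by
  intro i j h
  have hmem : ∀ k, (name C k, sgn C k) ∈ C := by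
    intro k
    have hk : (k : ℕ) < C.length := by omega
    have : (name C k, sgn C k) = C[(k : ℕ)] := by simp [name, sgn, hk]
    rw [this]
    exact List.getElem_mem _
  refine instLit_injective_of_nodup (n := 0) h3 hC ?_
  have : sgn C i = sgn C j := by
    by_contra hne
    refine ht _ (hmem i) ?_
    have hj := hmem j
    rwa [← h, Bool.eq_not_of_ne (Ne.symm hne)] at hj
  simp [instLit, h, this]

/-- The formulas whose clauses consist of three literals with distinct variables. -/
def Proper (G : List Clause) : Prop :=
  ∀ C ∈ G, C.length = 3 ∧ C.Nodup ∧ ∀ l ∈ C, (l.1, !l.2) ∉ C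

/-- If the literal `l` of the entry `y` is known to be true, and its variable becomes true because
of an entry `y'`, then also because of `y`. For a chain variable the value is determined by its
index, the other auxiliary variables are local to a block or an end of the chain, and the variables
of the given formula only become true in the block of the missing clause, where they are
distinct. -/
theorem svarValue_congr {G : List Clause} (hG : Proper G) {x y y' : Entry} (hx : x.Valid G)
    (hy : y.Valid G) (hy' : y'.Valid G) {l l' : SLit} (hl : l ∈ template y.kind)
    (hl' : l' ∈ template y'.kind)
    (h : (instLit y.idx y.cls l).1 = (instLit y'.idx y'.cls l').1)
    (hc : certOf (symVal x.kind (x.phase y)) (x.phase y) l = true)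
    (hv : svarValue x.kind (x.phase y') y'.cls l'.1 = true) :
    svarValue x.kind (x.phase y) y.cls l.1 = true := by
  obtain ⟨v, p⟩ := l
  obtain ⟨v', p'⟩ := l'
  cases v with
  | lit i =>
    cases v' with
    | aux j' d' => simp [instLit, auxVar] at h
    | lit i' =>
      simp only [certOf, svarValue, Bool.and_eq_true, decide_eq_true_eq] at hc hv
      obtain ⟨hb, hyb, hi⟩ := Entry.phase_eq_one hc.1
      obtain ⟨-, hyb', hi'⟩ := Entry.phase_eq_one hv.1
      have hcls := cls_eq hy hy' hyb hyb' (hi.trans hi'.symm)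
      obtain ⟨G₁, G₂, hGe, -⟩ := hy.block hyb
      obtain ⟨h3, hn, ht⟩ := hG y.cls (by rw [hGe]; simp)
      have hii : i = i' := name_injective h3 hn ht (by
        simp only [instLit, List.cons.injEq, true_and] at h
        rw [h, hcls])
      subst hii
      simp only [svarValue, hc.1, hcls]
      rw [hv.1] at hv
      simpa using hv.2
  | aux j d =>
    cases v' with
    | lit i' => simp [instLit, auxVar] at h
    | aux j' d' =>
      obtain ⟨rfl, hidx⟩ := auxVar_inj.1 h
      rw [← hv]
      simp only [svarValue]
      rcases aux_cases _ _ hl _ _ _ rfl with ⟨hj, hd⟩ | ⟨hj, rfl, hb⟩ | ⟨hj, rfl⟩ <;>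
      rcases aux_cases _ _ hl' _ _ _ rfl with ⟨hj', hd'⟩ | ⟨hj', rfl, hb'⟩ | ⟨hj', rfl⟩
      · rw [symVal_chain hx hy hj hd, symVal_chain hx hy' hj' hd', hidx]
      any_goals omega
      · have : x.phase y = x.phase y' := by
          simp only [inBlock, Bool.and_eq_true, decide_eq_true_eq] at hb hb'
          simp only [Bool.toNat_false, add_zero] at hidx
          have h₁ := not_lt.2 hb.1
          have h₂ := not_le.2 hb.2
          have h₃ := not_lt.2 hb'.1
          have h₄ := not_le.2 hb'.2
          simp only [Entry.phase, effPhase, hidx, h₁, h₂, h₃, h₄, if_false]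
        rw [this]
      · have : x.phase y = x.phase y' := by
          simp only [Bool.toNat_false, add_zero] at hidx
          have hp : pairOf y.kind = pairOf y'.kind := by omega
          rw [Entry.phase, Entry.phase, hidx, effPhase_congr _ _ hp]
        rw [this]

/-- Every remaining clause has a literal that is known to be true by `exists_cert`. If the literal
is positive, its variable is collected from this clause. Otherwise no other clause contributes the
variable, by `svarValue_congr`. -/
theorem satisfies_criticalAssignment {G : List Clause} (hG : Proper G) {L₁ L₂ : List Entry}
    {x : Entry} (h : entries G = L₁ ++ x :: L₂) :
    Satisfies (FinAssignment.eval (criticalAssignment ((L₁ ++ L₂).map Entry.clause)))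
      ((L₁ ++ L₂).map Entry.clause) := by
  have hsub : ∀ y ∈ L₁ ++ L₂, y ∈ entries G := by
    intro y hy
    rw [h]
    simp only [List.mem_append, List.mem_cons] at hy ⊢
    tauto
  have hx : x.Valid G := valid_of_mem_entries (by rw [h]; simp)
  rw [criticalAssignment_eq h]
  intro D hD
  obtain ⟨y, hy, rfl⟩ := List.mem_map.1 hD
  have hyv := valid_of_mem_entries (hsub y hy)
  have hne : (y.kind, y.idx) ≠ (x.kind, x.idx) := by
    have hn := nodup_entries G
    rw [h, List.map_append, List.map_cons, List.nodup_middle, List.nodup_cons,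
      ← List.map_append] at hn
    exact fun e => hn.1 (e ▸ List.mem_map_of_mem hy)
  have hcond : y.kind ≠ x.kind ∨ inBlock x.kind = true ∧ phaseAt x.idx y.idx ≠ 1 := by
    by_cases hk : y.kind = x.kind
    · have hi : y.idx ≠ x.idx := fun hi => hne (Prod.ext hk hi)
      refine .inr ⟨?_, ?_⟩
      · by_contra hb
        simp only [inBlock, Bool.and_eq_true, decide_eq_true_eq] at hb
        by_cases h4 : x.kind.val < 4
        · exact hi ((hyv.end_idx (hk ▸ h4)).trans (hx.end_idx h4).symm)
        · have h24 : 24 ≤ x.kind.val := by omega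
          exact hi ((hyv.start_idx (hk ▸ h24)).trans (hx.start_idx h24).symm)
      · unfold phaseAt
        split_ifs <;> simp_all
    · exact .inl hk
  obtain ⟨l, hl, hc⟩ := exists_cert x.kind y.kind (phaseAt x.idx y.idx) hcond
  change certOf (symVal x.kind (x.phase y)) (x.phase y) l = true at hc
  refine ⟨instLit y.idx y.cls l, List.mem_map_of_mem hl, ?_⟩
  have hτ : FinAssignment.eval (addVars x [] (L₁ ++ L₂)) (instLit y.idx y.cls l).1 =
      svarValue x.kind (x.phase y) y.cls l.1 := by
    rw [Bool.eq_iff_iff, FinAssignment.eval, decide_eq_true_eq, mem_addVars]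
    constructor
    · rintro (⟨y', hy', hv⟩ | hv)
      · obtain ⟨l', hl', hv, hv'⟩ := mem_trueVars.1 hv
        exact svarValue_congr hG hx hyv (valid_of_mem_entries (hsub y' hy')) hl hl' hv hc hv'
      · simp at hv
    · exact fun hv => .inl ⟨y, hy, mem_trueVars.2 ⟨l, hl, rfl, hv⟩⟩
  rw [hτ]
  obtain ⟨v, p⟩ := l
  cases v with
  | lit i =>
    simp only [certOf, Bool.and_eq_true, decide_eq_true_eq, beq_iff_eq] at hc
    simp [svarValue, instLit, hc.1, ← hc.2]
  | aux j d => simpa [certOf, svarValue, instLit] using hc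

theorem satisfies_deleteClause {φ : Formula} (h : φ ∈ E3CNF) (i : Fin (reduction φ).length) :
    Satisfies (FinAssignment.eval (criticalAssignment (deleteClause (reduction φ) i)))
      (deleteClause (reduction φ) i) := by
  have hG : Proper (relevant φ) := fun C hC => (mem_relevant h hC).2
  have he : reduction φ = (entries (relevant φ)).map Entry.clause := by
    rw [reduction_of_mem h, map_clause_entries]
  have hi : (i : ℕ) < (entries (relevant φ)).length := by
    have := i.2
    simpa only [he, List.length_map] using this
  have hd : deleteClause (reduction φ) i = ((entries (relevant φ)).take i ++
      (entries (relevant φ)).drop (i + 1)).map Entry.clause := by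
    rw [← List.eraseIdx_eq_take_drop_succ, ← List.eraseIdx_map, ← he, deleteClause]
  rw [hd]
  refine satisfies_criticalAssignment hG (x := (entries (relevant φ))[(i : ℕ)]) ?_
  rw [List.getElem_cons_drop, List.take_append_drop]

end CNFSat

theorem mainTheorem7 :
    ∃ (f : CNFSat.Formula → CNFSat.Formula) (sat : CNFSat.Formula → CNFSat.FinAssignment),
      CNFSat.IsPolyTimeManyOneReduction CNFSat.formulaEncoding CNFSat.formulaEncoding
        CNFSat.E3SAT CNFSat.E3SAT f ∧
      CNFSat.PolyTimeComputable CNFSat.formulaEncoding CNFSat.assignmentEncoding sat ∧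
      ∀ φ ∈ CNFSat.E3CNF, f φ ∈ CNFSat.E3CNF ∧
        ∀ i : Fin (f φ).length,
          CNFSat.Satisfies (CNFSat.FinAssignment.eval (sat (CNFSat.deleteClause (f φ) i)))
            (CNFSat.deleteClause (f φ) i) :=
  ⟨CNFSat.reduction, CNFSat.criticalAssignment,
    ⟨CNFSat.polyTimeComputable_reduction, CNFSat.mem_iff_reduction_mem⟩,
    CNFSat.polyTimeComputable_criticalAssignment,
    fun _ h => ⟨CNFSat.reduction_mem h, CNFSat.satisfies_deleteClause h⟩⟩
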